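/- Let $0\le q<r\le n$ be integers. Let $\mathcal A,\mathcal D$ be real $n\times n$ matrices, $\mathcal B=(\mathcal B_1,\mathcal B_2)$ a real $n\times r$ matrix with blocks of $q$ and $r-q$ columns, $G=\mathrm{diag}(g_1,\dots,g_q,0,\dots,0)$ of size $r\times r$, $\mathcal F:[0,\infty)\to\mathbb R^n$ measurable, $Z_0\in\mathbb R^n$, and $\mathcal B_c$ a real $n\times(n-r)$ matrix such that $(\mathcal B_c,\mathcal B)$ is nonsingular. Assume: (A1) $\mathcal B$ has full rank $r$; (A2) $\mathcal D$ is symmetric positive semidefinite; (A3) $g_k>0$ for $k=1,\dots,q$; (A4) there are $a,\gamma>0$ with $\|\mathcal F(t)\|\le a e^{-\gamma t}$ for all $t\ge0$; (A5) $\det(\mathcal B_2^T\mathcal D\mathcal B_2)\ne0$. Put $\widetilde{\mathcal B}_c=(\mathcal B_c,\mathcal B_1)$, $D_2=\mathcal B_2^T\mathcal D\mathcal B_2$, $\mathcal H=D_2^{-1}\mathcal B_2^T\mathcal D\widetilde{\mathcal B}_c$, $\mathcal L=\widetilde{\mathcal B}_c-\mathcal B_2\mathcal H$, $T=(\mathcal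 L,\mathcal B_2)$ (which is nonsingular), and $$A=T^{-1}\mathcal A T,\quad B=T^{-1}\mathcal B,\quad D=T^T\mathcal D T,\quad f(t)=T^{-1}\mathcal F(t),\quad z_0=T^{-1}Z_0 .$$ Let $A_1$ and $A_2$ be the upper left $(n-r+q)\times(n-r+q)$ and upper right $(n-r+q)\times(r-q)$ blocks of $A$, let $f_1(t)$ and $x_0$ be the upper blocks of size $n-r+q$ of $f(t)$ and $z_0$, and put $$D_1=\mathcal L^T\mathcal D\mathcal L,\quad \widetilde B=\begin{pmatrix}0_{(n-r)\times q}\\ I_q\end{pmatrix},\quad \bar B=(\widetilde B,A_2),\quad S_0=A_2D_2^{-1}A_2^T+\begin{pmatrix}0&0\\0&\mathrm{diag}(g_1,\dots,g_q)^{-1}\end{pmatrix}.$$ Let $F_1$ be a matrix with $D_1=F_1^TF_1$. Assume further: (A6) the pair $(A_1,\bar B)$ is stabilizable; (A7) the pair $(A_1,F_1)$ is detectable. *The regularized (partial cheap control) problem.* Let $M_u$ be the set of all state-feedback controls $u(z,t)$, $u:\mathbb R^n\times[0,\infty)\to\mathbb R^r$, measurable in $t$ for each $z$ and locally Lipschitz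 in $z$ uniformly in $t\ge0$, for which the initial value problem $$\dot z(t)=Az(t)+Bu(z(t),t)+f(t),\qquad z(0)=z_0,$$ has a unique locally absolutely continuous solution on $[0,\infty)$, and both $z(t)$ and $u(z(t),t)$ are square integrable on $[0,\infty)$. For $\varepsilon>0$ let $J_\varepsilon^*$ be the minimum over $u\in M_u$ of $$J_\varepsilon(u)=\int_0^\infty\big[z^T(t)Dz(t)+u^T(t)(G+\mathcal E)u(t)\big]dt,\qquad \mathcal E=\mathrm{diag}(\underbrace{0,\dots,0}_{q},\underbrace{\varepsilon^2,\dots,\varepsilon^2}_{r-q}),$$ where $u(t)=u(z(t),t)$. *The limit value.* Let $P_{10}^*$ be the symmetric positive semidefinite solution of $$P_{10}A_1+A_1^TP_{10}-P_{10}S_0P_{10}+D_1=0,$$ let $\mathcal A_0=A_1-S_0P_{10}^*$, and let $h_{10}$, $s_0$ be the locally absolutely continuous solutions on $[0,\infty)$ of $$\dot h_{10}(t)=-\mathcal A_0^Th_{10}(t)-P_{10}^*f_1(t),\quad h_{10}(+\infty)=0,$$ $$\dot s_0(t)=-2h_{10}^T(t)f_1(t)+h_{10}^T(t)S_0h_{10}(t),\quad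 s_0(+\infty)=0.$$ Put $\bar J^*=x_0^TP_{10}^*x_0+2h_{10}^T(0)x_0+s_0(0)$. **Claim.** $P_{10}^*$, $h_{10}$ and $s_0$ exist and are unique, so $\bar J^*$ is well defined. There is $\varepsilon_2>0$, which does not depend on $Z_0$, such that for every $Z_0$ there is a constant $c>0$, independent of $\varepsilon$, such that for all $\varepsilon\in(0,\varepsilon_2]$ the minimum $J_\varepsilon^*$ exists (it is attained in $M_u$) and $$\big|J_\varepsilon^*-\bar J^*\big|\le c\,\varepsilon .$$ -/

import Mathlib

open Matrix MeasureTheory Set Filter Topology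

noncomputable section

namespace CheapControl

/-! ### Linear systems -/

/-- A real square matrix is Hurwitz if all its complex eigenvalues have negative real part. -/
def IsHurwitz {ι : Type*} [Fintype ι] [DecidableEq ι] (M : Matrix ι ι ℝ) : Prop :=
  ∀ l ∈ spectrum ℂ (M.map (algebraMap ℝ ℂ)), l.re < 0

/-- The pair `(A, B)` is stabilizable: some state feedback makes the closed loop Hurwitz. -/
def IsStabilizable {ι κ : Type*} [Fintype ι] [DecidableEq ι] [Fintype κ]
    (A : Matrix ι ι ℝ) (B : Matrix ι κ ℝ) : Prop :=
  ∃ K : Matrix κ ι ℝ, IsHurwitz (A + B * K)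

/-- The pair `(A, F)` is detectable: some output injection makes `A + L F` Hurwitz. -/
def IsDetectable {ι κ : Type*} [Fintype ι] [DecidableEq ι] [Fintype κ]
    (A : Matrix ι ι ℝ) (F : Matrix κ ι ℝ) : Prop :=
  ∃ L : Matrix ι κ ℝ, IsHurwitz (A + L * F)

/-- `z` is a locally absolutely continuous solution on `[0, +∞)` of `dz/dt = v t z`
(equation satisfied almost everywhere), expressed as the equivalent integral equation with
locally integrable right-hand side. The values of `z` at negative times play no role. -/
def IsSolution {E : Type*} [NormedAddCommGroup E] [NormedSpace ℝ E]
    (v : ℝ → E → E) (z : ℝ → E) : Prop :=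
  ∀ t : ℝ, 0 ≤ t →
    IntervalIntegrable (fun s => v s (z s)) volume 0 t ∧
      z t = z 0 + ∫ s in (0 : ℝ)..t, v s (z s)

/-! ### Data of the problem

The state dimension is `n = p + q + m` and the control dimension is `r = q + m`, where the first
`q` control coordinates are regular and the last `m = r - q` are singular. The `n` state
coordinates are labelled by `StateIx p q m`, the `r` control coordinates by `Fin q ⊕ Fin m`,
so that every matrix comes with its partition into blocks. -/

/-- Labels of the upper block (of size `n - r + q = p + q`) of the state coordinates. -/
abbrev SlowIx (p q : ℕ) : Type := Fin p ⊕ Fin q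

/-- Labels of the `n = p + q + m` state coordinates. -/
abbrev StateIx (p q m : ℕ) : Type := SlowIx p q ⊕ Fin m

/-- Labels of the `r = q + m` control coordinates. -/
abbrev CtrlIx (q m : ℕ) : Type := Fin q ⊕ Fin m

/-- The raw data of the initial control problem
`dZ/dt = 𝒜 Z + ℬ U + ℱ(t)`, cost `∫ (Zᵀ 𝒟 Z + Uᵀ G U) dt`, `G = diag(g₁, …, g_q, 0, …, 0)`,
together with the chosen complement `ℬc` of the matrix `ℬ`. -/
structure Data (p q m : ℕ) where
  /-- the state matrix -/
  𝒜 : Matrix (StateIx p q m) (StateIx p q m) ℝ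
  /-- the control matrix -/
  ℬ : Matrix (StateIx p q m) (CtrlIx q m) ℝ
  /-- the complement of the control matrix -/
  ℬc : Matrix (StateIx p q m) (Fin p) ℝ
  /-- the weight of the state in the cost -/
  𝒟 : Matrix (StateIx p q m) (StateIx p q m) ℝ
  /-- the nonzero diagonal entries of the weight of the control -/
  g : Fin q → ℝ
  /-- the disturbance -/
  ℱ : ℝ → StateIx p q m → ℝ

namespace Data

variable {p q m : ℕ} (d : Data p q m)

/-! ### Transformation of the state -/

/-- The first `q` columns of `ℬ`. -/
def ℬ₁ : Matrix (StateIx p q m) (Fin q) ℝ := d.ℬ.toCols₁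

/-- The last `r - q` columns of `ℬ`. -/
def ℬ₂ : Matrix (StateIx p q m) (Fin m) ℝ := d.ℬ.toCols₂

/-- The complement `(ℬc, ℬ₁)` of `ℬ₂`. -/
def ℬtc : Matrix (StateIx p q m) (SlowIx p q) ℝ := fromCols d.ℬc d.ℬ₁

/-- `D₂ = ℬ₂ᵀ 𝒟 ℬ₂`. -/
def D₂ : Matrix (Fin m) (Fin m) ℝ := d.ℬ₂ᵀ * d.𝒟 * d.ℬ₂

/-- `ℋ = (ℬ₂ᵀ 𝒟 ℬ₂)⁻¹ ℬ₂ᵀ 𝒟 (ℬc, ℬ₁)`. -/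
def ℋ : Matrix (Fin m) (SlowIx p q) ℝ := d.D₂⁻¹ * d.ℬ₂ᵀ * d.𝒟 * d.ℬtc

/-- `ℒ = (ℬc, ℬ₁) - ℬ₂ ℋ`. -/
def ℒ : Matrix (StateIx p q m) (SlowIx p q) ℝ := d.ℬtc - d.ℬ₂ * d.ℋ

/-- The matrix `(ℒ, ℬ₂)` of the change of state `Z = (ℒ, ℬ₂) z`. -/
def T : Matrix (StateIx p q m) (StateIx p q m) ℝ := fromCols d.ℒ d.ℬ₂

/-- `A = (ℒ, ℬ₂)⁻¹ 𝒜 (ℒ, ℬ₂)`. -/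
def A : Matrix (StateIx p q m) (StateIx p q m) ℝ := d.T⁻¹ * d.𝒜 * d.T

/-- `B = (ℒ, ℬ₂)⁻¹ ℬ`. -/
def B : Matrix (StateIx p q m) (CtrlIx q m) ℝ := d.T⁻¹ * d.ℬ

/-- `D = (ℒ, ℬ₂)ᵀ 𝒟 (ℒ, ℬ₂)`. -/
def D : Matrix (StateIx p q m) (StateIx p q m) ℝ := d.Tᵀ * d.𝒟 * d.T

/-- `f(t) = (ℒ, ℬ₂)⁻¹ ℱ(t)`. -/
def f (t : ℝ) : StateIx p q m → ℝ := d.T⁻¹ *ᵥ d.ℱ t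

/-- The new initial state `z₀ = (ℒ, ℬ₂)⁻¹ Z₀`. -/
def z₀ (Z₀ : StateIx p q m → ℝ) : StateIx p q m → ℝ := d.T⁻¹ *ᵥ Z₀

/-! ### The partial cheap control problem -/

/-- The weight `G + ℰ = diag(g₁, …, g_q, ε², …, ε²)` of the control. -/
def Gε (ε : ℝ) : Matrix (CtrlIx q m) (CtrlIx q m) ℝ :=
  Matrix.diagonal (Sum.elim d.g (fun _ => ε ^ 2))

/-- `z` is the trajectory of `dz/dt = A z + B u(z, t) + f(t)`, `z(0) = z₀`, under the
state-feedback control `u`. -/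
def IsTrajectory (Z₀ : StateIx p q m → ℝ) (u : (StateIx p q m → ℝ) → ℝ → CtrlIx q m → ℝ)
    (z : ℝ → StateIx p q m → ℝ) : Prop :=
  IsSolution (fun t w => d.A *ᵥ w + d.B *ᵥ u w t + d.f t) z ∧ z 0 = d.z₀ Z₀

/-- The cost of the regularized problem along a trajectory `z` with control values `v`. -/
def costε (ε : ℝ) (z : ℝ → StateIx p q m → ℝ) (v : ℝ → CtrlIx q m → ℝ) : ℝ :=
  ∫ t in Ioi (0 : ℝ), (z t ⬝ᵥ (d.D *ᵥ z t) + v t ⬝ᵥ (d.Gε ε *ᵥ v t))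

end Data

/-- The class of feedbacks `u(w, t)`, `t ≥ 0`, which are (Lebesgue) measurable in `t` for fixed
`w` and locally Lipschitz in `w` uniformly in `t ≥ 0`. -/
structure IsFeedback {ι κ : Type*} [Fintype ι] [Fintype κ]
    (u : (ι → ℝ) → ℝ → κ → ℝ) : Prop where
  measurable : ∀ w, AEMeasurable (u w) (volume.restrict (Ici (0 : ℝ)))
  lipschitz : ∀ w₀, ∃ K : NNReal, ∃ N ∈ 𝓝 w₀, ∀ t : ℝ, 0 ≤ t →
    LipschitzOnWith K (fun w => u w t) N

namespace Data

variable {p q m : ℕ} (d : Data p q m)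

/-- The set `M_u` of admissible state-feedback controls: `u` is in the feedback class, the
initial-value problem has a unique solution on `[0, +∞)`, and both the solution and the control
along it are square integrable. -/
structure IsAdmissible (Z₀ : StateIx p q m → ℝ)
    (u : (StateIx p q m → ℝ) → ℝ → CtrlIx q m → ℝ) : Prop where
  feedback : IsFeedback u
  exists_trajectory : ∃ z, d.IsTrajectory Z₀ u z
  unique : ∀ z z', d.IsTrajectory Z₀ u z → d.IsTrajectory Z₀ u z' → EqOn z z' (Ici 0)
  state_sq : ∀ z, d.IsTrajectory Z₀ u z → MemLp z 2 (volume.restrict (Ioi (0 : ℝ)))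
  control_sq : ∀ z, d.IsTrajectory Z₀ u z →
    MemLp (fun t => u (z t) t) 2 (volume.restrict (Ioi (0 : ℝ)))

/-- All values `J_ε(u)`, `u ∈ M_u`, of the cost functional of the partial cheap control problem.
The optimal value `J_ε*` is the least element of this set. -/
def costValues (Z₀ : StateIx p q m → ℝ) (ε : ℝ) : Set ℝ :=
  {J | ∃ u z, d.IsAdmissible Z₀ u ∧ d.IsTrajectory Z₀ u z ∧
    J = d.costε ε z (fun t => u (z t) t)}

/-! ### The reduced quantities -/

/-- The upper left block `A₁` of `A`. -/
def A₁ : Matrix (SlowIx p q) (SlowIx p q) ℝ := d.A.toBlocks₁₁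

/-- The upper right block `A₂` of `A`. -/
def A₂ : Matrix (SlowIx p q) (Fin m) ℝ := d.A.toBlocks₁₂

/-- `D₁ = ℒᵀ 𝒟 ℒ`. -/
def D₁ : Matrix (SlowIx p q) (SlowIx p q) ℝ := d.ℒᵀ * d.𝒟 * d.ℒ

/-- `B̄ = (B̃, A₂)`, where `B̃` has the zero block above the identity. -/
def Bbar : Matrix (SlowIx p q) (CtrlIx q m) ℝ :=
  fromCols (fromRows (0 : Matrix (Fin p) (Fin q) ℝ) (1 : Matrix (Fin q) (Fin q) ℝ)) d.A₂

/-- `S₁ = diag(0, G̃⁻¹)`, `G̃ = diag(g₁, …, g_q)`. -/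
def S₁ : Matrix (SlowIx p q) (SlowIx p q) ℝ :=
  fromBlocks 0 0 0 (Matrix.diagonal d.g)⁻¹

/-- `S₀ = A₂ D₂⁻¹ A₂ᵀ + S₁`. -/
def S₀ : Matrix (SlowIx p q) (SlowIx p q) ℝ := d.A₂ * d.D₂⁻¹ * d.A₂ᵀ + d.S₁

/-- The upper block `f₁` of `f`. -/
def f₁ (t : ℝ) : SlowIx p q → ℝ := fun i => d.f t (Sum.inl i)

/-- The upper block `x₀` of `z₀`. -/
def x₀ (Z₀ : StateIx p q m → ℝ) : SlowIx p q → ℝ := fun i => d.z₀ Z₀ (Sum.inl i)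

/-- `(P, h, s)` are the quantities `(P₁₀*, h₁₀, s₀)`: a symmetric positive semidefinite solution
of the reduced Riccati equation and solutions of the two terminal-value problems. -/
structure IsReducedSolution (P : Matrix (SlowIx p q) (SlowIx p q) ℝ)
    (h : ℝ → SlowIx p q → ℝ) (s : ℝ → ℝ) : Prop where
  posSemidef : P.PosSemidef
  riccati : P * d.A₁ + d.A₁ᵀ * P - P * d.S₀ * P + d.D₁ = 0
  h_eq : IsSolution (fun t w => -((d.A₁ - d.S₀ * P)ᵀ *ᵥ w) - P *ᵥ d.f₁ t) h
  h_lim : Tendsto h atTop (𝓝 0)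
  s_eq : IsSolution (fun t _ => -2 * (h t ⬝ᵥ d.f₁ t) + h t ⬝ᵥ (d.S₀ *ᵥ h t)) s
  s_lim : Tendsto s atTop (𝓝 0)

/-- `J̄* = x₀ᵀ P₁₀* x₀ + 2 h₁₀(0)ᵀ x₀ + s₀(0)`. -/
def Jbar (Z₀ : StateIx p q m → ℝ) (P : Matrix (SlowIx p q) (SlowIx p q) ℝ)
    (h : ℝ → SlowIx p q → ℝ) (s : ℝ → ℝ) : ℝ :=
  d.x₀ Z₀ ⬝ᵥ (P *ᵥ d.x₀ Z₀) + 2 * (h 0 ⬝ᵥ d.x₀ Z₀) + s 0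

end Data

end CheapControl

end

/-!
The cost of the regularized problem is bounded below by the cost of the reduced problem, and the
bound is attained up to `O(ε)` by an explicit control.

Both problems are linear-quadratic problems with an exponentially decaying disturbance
(`IsValueTriple`). For such a problem, stabilizability and detectability give a positive
semidefinite solution `P` of the Riccati equation by Kleinman's iteration (`exists_riccati`), and
`P` is stabilizing and unique (`isHurwitz_of_riccati`, `riccati_unique`). A Hurwitz matrix generates
an exponentially decaying group (`IsHurwitz.exists_norm_flow_le`, from Gelfand's formula), which
provides the unique decaying solutions `h` and `s` of the two terminal-value problems. Completing
the square along a square integrable trajectory gives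
`cost = xᵀ P x + 2 hᵀ x + s + ∫ (u - u*)ᵀ R (u - u*)` at the initial point, with `u*` the optimal
feedback (`IsValueTriple.cost_eq`). Hence the infimum is attained and equals `xᵀ P x + 2 hᵀ x + s`.

In the transformed coordinates `D = diag(D₁, D₂)`, so with the slow state `x`, the fast state `y`
and the controls `u₁`, `u₂` the regularized cost is
`∫ (xᵀ D₁ x + yᵀ D₂ y + u₁ᵀ G̃ u₁) + ε² ∫ |u₂|²`. The first integral is the cost of the reduced
problem, in which `(u₁, y)` is the control with weight `diag(G̃, D₂)`; this gives the lower bound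
`J̄* ≤ J_ε*`. For the upper bound (`IsValueTriple.exists_composite_control`) let `(u₁, y)` be the
optimal feedback of the reduced problem plus `e^{-t/ε}` times a vector in the `y`-component that
corrects the initial value of `y`, and define `u₂` by solving the equation for `y'`. The layer has
energy `O(ε)`, and `u₂` is the sum of a term bounded in `L²` and of `-1/ε` times the layer, so the
two excess terms are `O(ε)`. Since controls that depend on time only are admissible feedbacks, no
feedback synthesis is needed, and any bound on `ε` will do, for instance `ε₂ = 1`.
-/

noncomputable section

namespace CheapControl

/-! ### Calculus of locally absolutely continuous functions -/

/-- `φ` is locally absolutely continuous on `[0, +∞)` with derivative `a` almost everywhere, in the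
integral form used by `IsSolution`: `IsSolution v z` is `IsPrimitive (fun t => v t (z t)) z`. -/
def IsPrimitive {E : Type*} [NormedAddCommGroup E] [NormedSpace ℝ E] (a φ : ℝ → E) : Prop :=
  IsSolution (fun t _ => a t) φ

theorem isSolution_iff_isPrimitive {E : Type*} [NormedAddCommGroup E] [NormedSpace ℝ E]
    {v : ℝ → E → E} {z : ℝ → E} :
    IsSolution v z ↔ IsPrimitive (fun t => v t (z t)) z := Iff.rfl

namespace IsPrimitive

section General

variable {E : Type*} [NormedAddCommGroup E] [NormedSpace ℝ E] {a b φ ψ : ℝ → E}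

theorem intervalIntegrable (h : IsPrimitive a φ) {t : ℝ} (ht : 0 ≤ t) :
    IntervalIntegrable a volume 0 t := (h t ht).1

theorem eq (h : IsPrimitive a φ) {t : ℝ} (ht : 0 ≤ t) :
    φ t = φ 0 + ∫ s in (0 : ℝ)..t, a s := (h t ht).2

theorem congr (h : IsPrimitive a φ) (hab : ∀ᵐ t ∂volume.restrict (Ioi (0 : ℝ)), a t = b t)
    (hφ : EqOn φ ψ (Ici 0)) : IsPrimitive b ψ := by
  intro t ht
  have hab' : a =ᵐ[volume.restrict (uIoc 0 t)] b := by
    refine ae_restrict_of_ae_restrict_of_subset ?_ hab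
    rw [uIoc_of_le ht]
    exact Ioc_subset_Ioi_self
  refine ⟨(h.intervalIntegrable ht).congr_ae hab', ?_⟩
  rw [← hφ ht, ← hφ self_mem_Ici, h.eq ht]
  congr 1
  exact intervalIntegral.integral_congr_ae_restrict hab'

theorem congr_deriv (h : IsPrimitive a φ) (hab : ∀ t, 0 ≤ t → a t = b t) : IsPrimitive b φ :=
  h.congr ((ae_restrict_mem measurableSet_Ioi).mono fun t ht => hab t (le_of_lt ht))
    (fun _ _ => rfl)

theorem of_integral [CompleteSpace E] (c : E) (ha : ∀ t, 0 ≤ t → IntervalIntegrable a volume 0 t) :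
    IsPrimitive a (fun t => c + ∫ s in (0 : ℝ)..t, a s) := by
  intro t ht
  simpa using ha t ht

theorem continuousOn (h : IsPrimitive a φ) : ContinuousOn φ (Ici 0) := by
  have key : ∀ T : ℝ, 0 ≤ T → ContinuousOn φ (Icc 0 T) := by
    intro T hT
    have h1 : ContinuousOn (fun t => φ 0 + ∫ s in (0 : ℝ)..t, a s) (Icc 0 T) := by
      refine continuousOn_const.add ?_
      have := intervalIntegral.continuousOn_primitive_interval' (h.intervalIntegrable hT)
        (left_mem_uIcc)
      rwa [uIcc_of_le hT] at this
    exact h1.congr fun t ht => h.eq ht.1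
  intro t ht
  have ht' : (0 : ℝ) ≤ t := ht
  have := key (t + 1) (by linarith) t ⟨ht', by linarith⟩
  refine this.mono_of_mem_nhdsWithin ?_
  rw [← Ici_inter_Iic]
  exact inter_mem self_mem_nhdsWithin (mem_nhdsWithin_of_mem_nhds (Iic_mem_nhds (by linarith)))

theorem add (h : IsPrimitive a φ) (h' : IsPrimitive b ψ) :
    IsPrimitive (fun t => a t + b t) (fun t => φ t + ψ t) := by
  intro t ht
  refine ⟨(h.intervalIntegrable ht).add (h'.intervalIntegrable ht), ?_⟩
  simp only
  rw [intervalIntegral.integral_add (h.intervalIntegrable ht) (h'.intervalIntegrable ht), h.eq ht,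
    h'.eq ht]
  abel

theorem const (c : E) : IsPrimitive (fun _ => 0) (fun _ => c) := by
  intro t _
  simp

theorem sum {ι : Type*} {s : Finset ι} {a φ : ι → ℝ → E}
    (h : ∀ i ∈ s, IsPrimitive (a i) (φ i)) :
    IsPrimitive (fun t => ∑ i ∈ s, a i t) (fun t => ∑ i ∈ s, φ i t) := by
  classical
  induction s using Finset.induction_on with
  | empty => simpa using const (0 : E)
  | insert i s hi ih =>
    simp only [Finset.sum_insert hi]
    exact (h i (Finset.mem_insert_self _ _)).add
      (ih fun j hj => h j (Finset.mem_insert_of_mem hj))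

theorem smul (c : ℝ) (h : IsPrimitive a φ) :
    IsPrimitive (fun t => c • a t) (fun t => c • φ t) := by
  intro t ht
  refine ⟨(h.intervalIntegrable ht).smul c, ?_⟩
  simp only
  rw [intervalIntegral.integral_smul, h.eq ht, smul_add]

theorem sub (h : IsPrimitive a φ) (h' : IsPrimitive b ψ) :
    IsPrimitive (fun t => a t - b t) (fun t => φ t - ψ t) := by
  simpa [sub_eq_add_neg] using h.add (h'.smul (-1))

theorem of_hasDerivAt [CompleteSpace E] (h : ∀ t, HasDerivAt φ (a t) t) (ha : Continuous a) :
    IsPrimitive a φ := by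
  intro t _
  refine ⟨ha.intervalIntegrable _ _, ?_⟩
  simp only
  rw [intervalIntegral.integral_eq_sub_of_hasDerivAt (fun s _ => h s)
    (ha.intervalIntegrable _ _)]
  abel

theorem eq_of_deriv_zero (h : IsPrimitive a φ) (ha : ∀ t, 0 ≤ t → a t = 0) {t : ℝ} (ht : 0 ≤ t) :
    φ t = φ 0 := by
  have := (h.congr_deriv (b := fun _ => 0) ha).eq ht
  simpa using this

/-- A primitive of an integrable function converges at infinity. -/
theorem tendsto (h : IsPrimitive a φ) (ha : IntegrableOn a (Ioi 0)) :
    Tendsto φ atTop (𝓝 (φ 0 + ∫ t in Ioi (0 : ℝ), a t)) := by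
  have h1 := (intervalIntegral_tendsto_integral_Ioi (0 : ℝ) ha tendsto_id).const_add (φ 0)
  refine h1.congr' ?_
  filter_upwards [eventually_ge_atTop (0 : ℝ)] with t ht
  exact (h.eq ht).symm

end General

/-- Product rule. -/
theorem mul {a b φ ψ : ℝ → ℝ} (h : IsPrimitive a φ) (h' : IsPrimitive b ψ) :
    IsPrimitive (fun t => a t * ψ t + φ t * b t) (fun t => φ t * ψ t) := by
  intro t ht
  have hia := h.intervalIntegrable ht
  have hib := h'.intervalIntegrable ht
  have hsub : uIcc 0 t ⊆ Ici (0 : ℝ) := by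
    rw [uIcc_of_le ht]
    exact Icc_subset_Ici_self
  have hφc := h.continuousOn.mono hsub
  have hψc := h'.continuousOn.mono hsub
  refine ⟨(hia.mul_continuousOn hψc).add (hib.continuousOn_mul hφc), ?_⟩
  have h0 : (0 : ℝ) ∈ uIcc 0 t := left_mem_uIcc
  have hac : ∀ {a φ : ℝ → ℝ}, IsPrimitive a φ → IntervalIntegrable a volume 0 t →
      AbsolutelyContinuousOnInterval (fun x => φ 0 + ∫ s in (0 : ℝ)..x, a s) 0 t := by
    intro a φ _ hi
    refine AbsolutelyContinuousOnInterval.add ?_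
      (hi.absolutelyContinuousOnInterval_intervalIntegral h0)
    exact (LipschitzWith.const (φ 0)).lipschitzOnWith.absolutelyContinuousOnInterval
  have hprod := ((hac h hia).fun_mul (hac h' hib)).integral_deriv_eq_sub
  have hval : ∀ {a φ : ℝ → ℝ}, IsPrimitive a φ → ∀ x ∈ uIcc 0 t,
      φ 0 + ∫ s in (0 : ℝ)..x, a s = φ x := fun h x hx => (h.eq (hsub hx)).symm
  have hcongr : ∫ x in (0 : ℝ)..t, (a x * ψ x + φ x * b x) =
      ∫ x in (0 : ℝ)..t, deriv (fun x => (φ 0 + ∫ s in (0 : ℝ)..x, a s) *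
        (ψ 0 + ∫ s in (0 : ℝ)..x, b s)) x := by
    apply intervalIntegral.integral_congr_ae
    filter_upwards [hia.ae_hasDerivAt_integral, hib.ae_hasDerivAt_integral] with x hx1 hx2 hx
    have hx' : x ∈ uIcc 0 t := uIoc_subset_uIcc hx
    have := ((hx1 hx' 0 h0).const_add (φ 0)).mul ((hx2 hx' 0 h0).const_add (ψ 0))
    have e := this.deriv
    rw [hval h x hx', hval h' x hx'] at e
    exact e.symm
  simp only
  rw [hcongr, hprod, hval h t right_mem_uIcc, hval h' t right_mem_uIcc]
  simp

section Vector

variable {ι κ : Type*} [Fintype ι] [Fintype κ]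

theorem pi {a φ : ℝ → ι → ℝ} (h : ∀ i, IsPrimitive (fun t => a t i) (fun t => φ t i)) :
    IsPrimitive a φ := by
  intro t ht
  have hi : ∀ i, IntegrableOn (fun t => a t i) (Ioc 0 t) := fun i =>
    (intervalIntegrable_iff_integrableOn_Ioc_of_le ht).1 ((h i).intervalIntegrable ht)
  refine ⟨(intervalIntegrable_iff_integrableOn_Ioc_of_le ht).2 (Integrable.of_eval hi), ?_⟩
  ext i
  simp only [Pi.add_apply]
  rw [(h i).eq ht, intervalIntegral.integral_of_le ht, intervalIntegral.integral_of_le ht,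
    eval_integral hi]

theorem apply {a φ : ℝ → ι → ℝ} (h : IsPrimitive a φ) (i : ι) :
    IsPrimitive (fun t => a t i) (fun t => φ t i) := by
  intro t ht
  have hi := (intervalIntegrable_iff_integrableOn_Ioc_of_le ht).1 (h.intervalIntegrable ht)
  have hi' : ∀ i, IntegrableOn (fun t => a t i) (Ioc 0 t) := fun i => Integrable.eval hi i
  refine ⟨(intervalIntegrable_iff_integrableOn_Ioc_of_le ht).2 (hi' i), ?_⟩
  have := congr_fun (h.eq ht) i
  simp only [Pi.add_apply] at this ⊢
  rw [this, intervalIntegral.integral_of_le ht, intervalIntegral.integral_of_le ht,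
    eval_integral hi']

theorem dotProduct {a b x y : ℝ → ι → ℝ} (h : IsPrimitive a x) (h' : IsPrimitive b y) :
    IsPrimitive (fun t => a t ⬝ᵥ y t + x t ⬝ᵥ b t) (fun t => x t ⬝ᵥ y t) := by
  have := sum (s := Finset.univ) fun i _ => (h.apply i).mul (h'.apply i)
  simp only [Finset.sum_add_distrib] at this
  exact this

theorem mulVec_of_hasDerivAt {Φ Φ' : ℝ → Matrix κ ι ℝ} {a x : ℝ → ι → ℝ}
    (hΦ : ∀ i j t, HasDerivAt (fun t => Φ t i j) (Φ' t i j) t)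
    (hc : ∀ i j, Continuous fun t => Φ' t i j) (h : IsPrimitive a x) :
    IsPrimitive (fun t => Φ' t *ᵥ x t + Φ t *ᵥ a t) (fun t => Φ t *ᵥ x t) := by
  refine pi fun i => ?_
  have := sum (s := Finset.univ) fun j _ =>
    (of_hasDerivAt (hΦ i j) (hc i j)).mul (h.apply j)
  simp only [Finset.sum_add_distrib] at this
  exact this

theorem mulVec (M : Matrix κ ι ℝ) {a x : ℝ → ι → ℝ} (h : IsPrimitive a x) :
    IsPrimitive (fun t => M *ᵥ a t) (fun t => M *ᵥ x t) := by
  have := mulVec_of_hasDerivAt (Φ := fun _ => M) (Φ' := 0)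
    (fun i j t => hasDerivAt_const t (M i j)) (fun i j => continuous_const) h
  simpa using this

end Vector

end IsPrimitive

/-! ### Hurwitz matrices and decay of the matrix exponential -/

section Hurwitz

variable {ι : Type*} [Fintype ι]

theorem mem_spectrum_iff_exists_mulVec [DecidableEq ι] {K : Type*} [Field K] {M : Matrix ι ι K} {l : K} :
    l ∈ spectrum K M ↔ ∃ v, v ≠ 0 ∧ M *ᵥ v = l • v := by
  rw [spectrum.mem_iff, Matrix.isUnit_iff_isUnit_det, isUnit_iff_ne_zero, not_not,
    ← Matrix.exists_mulVec_eq_zero_iff]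
  refine exists_congr fun v => and_congr_right fun _ => ?_
  rw [Matrix.sub_mulVec, sub_eq_zero, Matrix.algebraMap_eq_diagonal, eq_comm]
  have : (Matrix.diagonal ((algebraMap K (ι → K)) l)) *ᵥ v = l • v := by
    ext i
    simp [Matrix.mulVec_diagonal]
  rw [this]

/-- A complex eigenvector `a + i b` for the eigenvalue `σ + i ω`, written with real vectors. -/
def IsEigenpair (M : Matrix ι ι ℝ) (σ ω : ℝ) (a b : ι → ℝ) : Prop :=
  M *ᵥ a = σ • a - ω • b ∧ M *ᵥ b = ω • a + σ • b

theorem isEigenpair_iff {M : Matrix ι ι ℝ} {l : ℂ} {v : ι → ℂ} :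
    M.map (algebraMap ℝ ℂ) *ᵥ v = l • v ↔
      IsEigenpair M l.re l.im (fun i => (v i).re) (fun i => (v i).im) := by
  have hre : ∀ i, ((M.map (algebraMap ℝ ℂ) *ᵥ v) i).re = (M *ᵥ fun i => (v i).re) i := by
    intro i
    simp [Matrix.mulVec, dotProduct]
  have him : ∀ i, ((M.map (algebraMap ℝ ℂ) *ᵥ v) i).im = (M *ᵥ fun i => (v i).im) i := by
    intro i
    simp [Matrix.mulVec, dotProduct]
  constructor
  · intro h
    constructor
    · ext i
      rw [← hre, h]
      simp
    · ext i
      rw [← him, h]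
      simp [add_comm]
  · rintro ⟨h1, h2⟩
    ext i
    apply Complex.ext
    · rw [hre, h1]
      simp
    · rw [him, h2]
      simp [add_comm]

variable [DecidableEq ι]

theorem isHurwitz_iff {M : Matrix ι ι ℝ} :
    IsHurwitz M ↔ ∀ σ ω a b, 0 ≤ σ → IsEigenpair M σ ω a b → a = 0 ∧ b = 0 := by
  constructor
  · intro h σ ω a b hσ hab
    by_contra hne
    let v : ι → ℂ := fun i => ⟨a i, b i⟩
    have hv : v ≠ 0 := by
      intro hv
      apply hne
      constructor
      · ext i
        simpa [v] using congr_arg Complex.re (congr_fun hv i)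
      · ext i
        simpa [v] using congr_arg Complex.im (congr_fun hv i)
    have := h ⟨σ, ω⟩ (mem_spectrum_iff_exists_mulVec.2 ⟨v, hv, isEigenpair_iff.2 hab⟩)
    exact absurd this (not_lt.2 hσ)
  · intro h l hl
    obtain ⟨v, hv, hl⟩ := mem_spectrum_iff_exists_mulVec.1 hl
    by_contra hneg
    obtain ⟨ha, hb⟩ := h _ _ _ _ (not_lt.1 hneg) (isEigenpair_iff.1 hl)
    apply hv
    ext i
    exact Complex.ext (congr_fun ha i) (congr_fun hb i)

theorem IsHurwitz.transpose {M : Matrix ι ι ℝ} (h : IsHurwitz M) : IsHurwitz Mᵀ := by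
  intro l hl
  refine h l ?_
  rw [spectrum.mem_iff, Matrix.isUnit_iff_isUnit_det] at hl ⊢
  rw [← Matrix.det_transpose, Matrix.transpose_sub]
  convert! hl using 5
  rw [Matrix.algebraMap_eq_diagonal, Matrix.diagonal_transpose]

end Hurwitz

section Decay

open scoped Matrix.Norms.Operator

variable {ι : Type*} [Fintype ι] [DecidableEq ι]

/-- The one-parameter group generated by `M`. -/
def flow (M : Matrix ι ι ℝ) (t : ℝ) : Matrix ι ι ℝ := NormedSpace.exp (t • M)

theorem flow_zero (M : Matrix ι ι ℝ) : flow M 0 = 1 := by simp [flow]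

theorem flow_add (M : Matrix ι ι ℝ) (s t : ℝ) : flow M (s + t) = flow M s * flow M t := by
  unfold flow
  rw [add_smul]
  exact NormedSpace.exp_add_of_commute (((Commute.refl M).smul_left s).smul_right t)

theorem flow_mul_neg (M : Matrix ι ι ℝ) (t : ℝ) : flow M t * flow M (-t) = 1 := by
  rw [← flow_add, add_neg_cancel, flow_zero]

theorem hasDerivAt_flow (M : Matrix ι ι ℝ) (t : ℝ) :
    HasDerivAt (flow M) (M * flow M t) t :=
  hasDerivAt_exp_smul_const' (𝕂 := ℝ) M t

theorem commute_flow (M : Matrix ι ι ℝ) (t : ℝ) : M * flow M t = flow M t * M :=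
  (hasDerivAt_flow M t).unique (hasDerivAt_exp_smul_const (𝕂 := ℝ) M t)

theorem continuous_flow (M : Matrix ι ι ℝ) : Continuous (flow M) :=
  continuous_iff_continuousAt.2 fun t => (hasDerivAt_flow M t).continuousAt

theorem hasDerivAt_apply {ι κ : Type*} [Fintype ι] [Fintype κ] {Φ : ℝ → Matrix κ ι ℝ} {Φ' : Matrix κ ι ℝ} {t : ℝ}
    (h : HasDerivAt Φ Φ' t) (i : κ) (j : ι) : HasDerivAt (fun t => Φ t i j) (Φ' i j) t := by
  have h1 : HasFDerivAt (fun N : Matrix κ ι ℝ => N i j)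
      (LinearMap.toContinuousLinearMap (Matrix.entryLinearMap ℝ ℝ i j)) (Φ t) :=
    (LinearMap.toContinuousLinearMap (Matrix.entryLinearMap ℝ ℝ i j)).hasFDerivAt
  exact h1.comp_hasDerivAt t h

theorem exp_mulVec_of_eigenvector {M : Matrix ι ι ℂ} {l : ℂ} {v : ι → ℂ} (h : M *ᵥ v = l • v) :
    NormedSpace.exp M *ᵥ v = Complex.exp l • v := by
  have hpow : ∀ n : ℕ, (M ^ n) *ᵥ v = l ^ n • v := by
    intro n
    induction n with
    | zero => simp
    | succ n ih => rw [pow_succ, ← Matrix.mulVec_mulVec, h, Matrix.mulVec_smul, ih, smul_smul,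
        pow_succ, mul_comm]
  have h1 := NormedSpace.exp_series_hasSum_exp' (𝕂 := ℂ) M
  have h2 := h1.mapL (LinearMap.toContinuousLinearMap ((Matrix.mulVecBilin ℂ ℂ).flip v))
  have h3 := (NormedSpace.exp_series_hasSum_exp' (𝕂 := ℂ) l).smul_const v
  rw [← Complex.exp_eq_exp_ℂ] at h3
  refine h2.unique ?_
  convert! h3 using 2 with n
  simp [hpow, smul_smul]

/-- The nontrivial inclusion of the spectral mapping theorem for the exponential: an eigenspace of
`exp M` is invariant under `M`, and hence contains an eigenvector of `M`. -/
theorem exists_of_mem_spectrum_exp {M : Matrix ι ι ℂ} {μ : ℂ}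
    (h : μ ∈ spectrum ℂ (NormedSpace.exp M)) : ∃ l ∈ spectrum ℂ M, μ = Complex.exp l := by
  obtain ⟨v, hv, hμ⟩ := mem_spectrum_iff_exists_mulVec.1 h
  let W := Module.End.eigenspace (Matrix.toLin' (NormedSpace.exp M)) μ
  have hcomm : M * NormedSpace.exp M = NormedSpace.exp M * M :=
    ((Commute.refl M).exp_right).eq
  have hW : ∀ w ∈ W, Matrix.toLin' M w ∈ W := by
    intro w hw
    simp only [W, Module.End.mem_eigenspace_iff, Matrix.toLin'_apply] at hw ⊢
    rw [Matrix.mulVec_mulVec, ← hcomm, ← Matrix.mulVec_mulVec, hw, Matrix.mulVec_smul]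
  have hvW : v ∈ W := by
    simpa only [W, Module.End.mem_eigenspace_iff, Matrix.toLin'_apply] using hμ
  have : Nontrivial W := ⟨⟨⟨v, hvW⟩, 0, fun h => hv (congr_arg Subtype.val h)⟩⟩
  obtain ⟨l, hl⟩ := Module.End.exists_eigenvalue ((Matrix.toLin' M).restrict hW)
  obtain ⟨w, hw⟩ := hl.exists_hasEigenvector
  have hw0 : (w : ι → ℂ) ≠ 0 := fun h => hw.2 (Subtype.ext h)
  have hwl : M *ᵥ (w : ι → ℂ) = l • (w : ι → ℂ) := congr_arg Subtype.val hw.apply_eq_smul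
  refine ⟨l, mem_spectrum_iff_exists_mulVec.2 ⟨w, hw0, hwl⟩, ?_⟩
  have h1 : NormedSpace.exp M *ᵥ (w : ι → ℂ) = μ • (w : ι → ℂ) := by
    have := w.2
    simpa only [W, Module.End.mem_eigenspace_iff, Matrix.toLin'_apply] using this
  rw [exp_mulVec_of_eigenvector hwl] at h1
  exact (smul_left_injective ℂ hw0 h1).symm

theorem norm_map_algebraMap (M : Matrix ι ι ℝ) : ‖M.map (algebraMap ℝ ℂ)‖ = ‖M‖ := by
  simp [Matrix.linfty_opNorm_def]

/-- By Gelfand's formula some power of `exp M` is a strict contraction when `M` is Hurwitz. -/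
theorem IsHurwitz.exists_norm_flow_lt_one {M : Matrix ι ι ℝ} (h : IsHurwitz M) :
    ∃ n : ℕ, 0 < n ∧ ‖flow M n‖ < 1 := by
  rcases isEmpty_or_nonempty ι with hι | hι
  · refine ⟨1, one_pos, ?_⟩
    rw [Subsingleton.elim (flow M _) 0, norm_zero]
    exact one_pos
  have hmap : NormedSpace.exp (M.map (algebraMap ℝ ℂ)) =
      (NormedSpace.exp M).map (algebraMap ℝ ℂ) := by
    have hc : Continuous ((algebraMap ℝ ℂ).mapMatrix : Matrix ι ι ℝ →+* Matrix ι ι ℂ) :=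
      Continuous.matrix_map continuous_id Complex.continuous_ofReal
    exact (NormedSpace.map_exp ((algebraMap ℝ ℂ).mapMatrix : Matrix ι ι ℝ →+* Matrix ι ι ℂ)
      hc M).symm
  have hrad : spectralRadius ℂ (NormedSpace.exp (M.map (algebraMap ℝ ℂ))) < (1 : NNReal) := by
    refine spectrum.spectralRadius_lt_of_forall_lt _ fun μ hμ => ?_
    obtain ⟨l, hl, rfl⟩ := exists_of_mem_spectrum_exp hμ
    rw [← NNReal.coe_lt_coe, coe_nnnorm, Complex.norm_exp, NNReal.coe_one, Real.exp_lt_one_iff]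
    exact h l hl
  have hlim := spectrum.pow_nnnorm_pow_one_div_tendsto_nhds_spectralRadius
    (NormedSpace.exp (M.map (algebraMap ℝ ℂ)))
  obtain ⟨n, hn1, hn⟩ := ((hlim.eventually_lt_const hrad).and (eventually_gt_atTop 0)).exists
  refine ⟨n, hn, ?_⟩
  have hn1' : (‖NormedSpace.exp (M.map (algebraMap ℝ ℂ)) ^ n‖₊ : ENNReal) < 1 := by
    by_contra hge
    refine absurd hn1 (not_lt.2 ?_)
    have := ENNReal.rpow_le_rpow (not_lt.1 hge) (z := 1 / (n : ℝ)) (by positivity)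
    simpa using this
  have hpow : flow M n = NormedSpace.exp M ^ n := by
    rw [flow, Nat.cast_smul_eq_nsmul]
    exact Matrix.exp_nsmul n M
  rw [hmap] at hn1'
  have h2 : (NormedSpace.exp M).map (algebraMap ℝ ℂ) ^ n =
      (NormedSpace.exp M ^ n).map (algebraMap ℝ ℂ) :=
    (map_pow ((algebraMap ℝ ℂ).mapMatrix : Matrix ι ι ℝ →+* Matrix ι ι ℂ) _ n).symm
  rw [h2, ← hpow, ENNReal.coe_lt_one_iff, ← NNReal.coe_lt_coe, coe_nnnorm,
    norm_map_algebraMap] at hn1'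
  exact hn1'

theorem IsHurwitz.exists_norm_flow_le {M : Matrix ι ι ℝ} (h : IsHurwitz M) :
    ∃ C α : ℝ, 0 < C ∧ 0 < α ∧ ∀ t, 0 ≤ t → ‖flow M t‖ ≤ C * Real.exp (-α * t) := by
  obtain ⟨n, hn, hlt⟩ := h.exists_norm_flow_lt_one
  have hn' : (0 : ℝ) < n := Nat.cast_pos.2 hn
  -- a positive upper bound for the norm over one period, still less than one
  obtain ⟨ρ, hρ1, hρ⟩ := exists_between (max_lt hlt one_half_lt_one)
  have hρ0 : 0 < ρ := lt_trans one_half_pos ((le_max_right _ _).trans_lt hρ1)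
  have hρn : ‖flow M n‖ ≤ ρ := (le_max_left _ _).trans hρ1.le
  obtain ⟨C₀, hC₀⟩ := (isCompact_Icc (a := (0 : ℝ)) (b := n)).exists_bound_of_continuousOn
    (continuous_flow M).continuousOn
  have hlog : Real.log ρ < 0 := Real.log_neg hρ0 hρ
  set α := -Real.log ρ / n with hα
  have hαpos : 0 < α := div_pos (neg_pos.2 hlog) hn'
  have hC0 : 0 ≤ C₀ := (norm_nonneg _).trans (hC₀ 0 ⟨le_rfl, hn'.le⟩)
  have hk : ∀ (k : ℕ) (s : ℝ), s ∈ Icc (0 : ℝ) n → ‖flow M (k * n + s)‖ ≤ ρ ^ k * C₀ := by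
    intro k
    induction k with
    | zero => intro s hs; simpa using hC₀ s hs
    | succ k ih =>
      intro s hs
      have : ((k + 1 : ℕ) : ℝ) * n + s = n + (k * n + s) := by push_cast; ring
      rw [this, flow_add, pow_succ', mul_assoc]
      exact (norm_mul_le _ _).trans
        (mul_le_mul hρn (ih s hs) (norm_nonneg _) hρ0.le)
  refine ⟨(C₀ + 1) * Real.exp (α * n), α, by positivity, hαpos, fun t ht => ?_⟩
  set k := ⌊t / n⌋₊
  have hk1 : (k : ℝ) * n ≤ t := (le_div_iff₀ hn').1 (Nat.floor_le (by positivity))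
  have hk2 : t < (k + 1) * n := (div_lt_iff₀ hn').1 (Nat.lt_floor_add_one _)
  have h1 := hk k (t - k * n) ⟨by linarith, by nlinarith⟩
  rw [add_sub_cancel] at h1
  have hρk : ρ ^ k = Real.exp (-α * (k * n)) := by
    rw [← Real.exp_log hρ0, ← Real.exp_nat_mul, hα]
    congr 1
    field_simp
  refine h1.trans ?_
  rw [hρk, mul_comm, mul_assoc, ← Real.exp_add]
  refine mul_le_mul (by linarith) (Real.exp_le_exp.2 ?_) (Real.exp_pos _).le (by linarith)
  nlinarith

theorem tendsto_zero_of_exp_bound {E : Type*} [NormedAddCommGroup E] {x : ℝ → E} {C γ : ℝ}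
    (hγ : 0 < γ) (h : ∀ t, 0 ≤ t → ‖x t‖ ≤ C * Real.exp (-γ * t)) : Tendsto x atTop (𝓝 0) := by
  refine squeeze_zero_norm' (a := fun t => C * Real.exp (-γ * t)) ?_ ?_
  · filter_upwards [eventually_ge_atTop (0 : ℝ)] with t ht using h t ht
  · have : Tendsto (fun t : ℝ => Real.exp (-γ * t)) atTop (𝓝 0) :=
      Real.tendsto_exp_atBot.comp (tendsto_id.const_mul_atTop_of_neg (neg_lt_zero.2 hγ))
    simpa using this.const_mul C

theorem IsHurwitz.tendsto_flow {M : Matrix ι ι ℝ} (h : IsHurwitz M) :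
    Tendsto (flow M) atTop (𝓝 0) := by
  obtain ⟨C, α, _, hα, hb⟩ := h.exists_norm_flow_le
  exact tendsto_zero_of_exp_bound hα hb

end Decay

/-! ### Lyapunov and Riccati equations -/

section Real

variable {ι : Type*} [Fintype ι]

theorem posSemidef_iff_real {M : Matrix ι ι ℝ} :
    M.PosSemidef ↔ Mᵀ = M ∧ ∀ x, 0 ≤ x ⬝ᵥ M *ᵥ x := by
  simp [Matrix.posSemidef_iff_dotProduct_mulVec, Matrix.IsHermitian]

theorem posDef_iff_real {M : Matrix ι ι ℝ} :
    M.PosDef ↔ Mᵀ = M ∧ ∀ ⦃x⦄, x ≠ 0 → 0 < x ⬝ᵥ M *ᵥ x := by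
  simp [Matrix.posDef_iff_dotProduct_mulVec, Matrix.IsHermitian]

theorem posSemidef_transpose_mul_mul {κ : Type*} [Fintype κ] {R : Matrix κ κ ℝ}
    (hR : R.PosSemidef) (K : Matrix κ ι ℝ) : (Kᵀ * R * K).PosSemidef := by
  simpa using hR.conjTranspose_mul_mul_same K

theorem dotProduct_transpose_mul_mul {κ : Type*} [Fintype κ] (R : Matrix κ κ ℝ)
    (K : Matrix κ ι ℝ) (x : ι → ℝ) :
    x ⬝ᵥ (Kᵀ * R * K) *ᵥ x = (K *ᵥ x) ⬝ᵥ R *ᵥ (K *ᵥ x) := by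
  rw [Matrix.mul_assoc, ← Matrix.mulVec_mulVec, Matrix.dotProduct_mulVec, Matrix.vecMul_transpose,
    Matrix.mulVec_mulVec]

theorem dotProduct_mulVec_transpose {κ : Type*} [Fintype κ] (M : Matrix κ ι ℝ) (x : κ → ℝ)
    (y : ι → ℝ) : x ⬝ᵥ M *ᵥ y = (Mᵀ *ᵥ x) ⬝ᵥ y := by
  rw [Matrix.dotProduct_mulVec, Matrix.mulVec_transpose]

theorem dotProduct_mulVec_symm {M : Matrix ι ι ℝ} (hM : Mᵀ = M) (x y : ι → ℝ) :
    x ⬝ᵥ M *ᵥ y = y ⬝ᵥ M *ᵥ x := by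
  rw [dotProduct_mulVec_transpose, hM, dotProduct_comm]

end Real

section Lyapunov

variable {ι : Type*} [Fintype ι]

/-- The Lyapunov equation tested on a complex eigenvector. -/
theorem IsEigenpair.lyapunov {M Y W : Matrix ι ι ℝ} {σ ω : ℝ} {a b : ι → ℝ}
    (h : IsEigenpair M σ ω a b) (hY : Yᵀ = Y) (hW : Mᵀ * Y + Y * M + W = 0) :
    2 * σ * (a ⬝ᵥ Y *ᵥ a + b ⬝ᵥ Y *ᵥ b) + (a ⬝ᵥ W *ᵥ a + b ⬝ᵥ W *ᵥ b) = 0 := by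
  have key : ∀ v, 2 * (v ⬝ᵥ Y *ᵥ (M *ᵥ v)) + v ⬝ᵥ W *ᵥ v = 0 := by
    intro v
    have h0 := congr_arg (fun N => v ⬝ᵥ N *ᵥ v) hW
    simp only [Matrix.add_mulVec, dotProduct_add, Matrix.zero_mulVec, dotProduct_zero] at h0
    rw [← Matrix.mulVec_mulVec, ← Matrix.mulVec_mulVec, dotProduct_mulVec_transpose Mᵀ,
      Matrix.transpose_transpose, dotProduct_mulVec_symm hY (M *ᵥ v) v] at h0
    linarith
  have ha := key a
  have hb := key b
  rw [h.1] at ha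
  rw [h.2] at hb
  simp only [Matrix.mulVec_add, Matrix.mulVec_sub, Matrix.mulVec_smul, dotProduct_add,
    dotProduct_sub, dotProduct_smul, smul_eq_mul] at ha hb
  rw [dotProduct_mulVec_symm hY b a] at hb
  linarith

variable [DecidableEq ι]

section

open scoped Matrix.Norms.Operator

theorem flow_transpose (M : Matrix ι ι ℝ) (t : ℝ) : (flow M t)ᵀ = flow Mᵀ t := by
  rw [flow, flow, ← Matrix.exp_transpose, Matrix.transpose_smul]

theorem hasDerivAt_flow_conj (M N X : Matrix ι ι ℝ) (t : ℝ) :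
    HasDerivAt (fun t => flow M t * X * flow N t) (flow M t * (M * X + X * N) * flow N t) t := by
  have := ((hasDerivAt_flow M t).mul_const X).mul (hasDerivAt_flow N t)
  convert! this using 1
  rw [commute_flow M t]
  simp only [Matrix.mul_add, Matrix.add_mul, Matrix.mul_assoc]

theorem tendsto_flow_conj {M N : Matrix ι ι ℝ} (hM : IsHurwitz M) (hN : IsHurwitz N)
    (X : Matrix ι ι ℝ) : Tendsto (fun t => flow M t * X * flow N t) atTop (𝓝 0) := by
  simpa using (hM.tendsto_flow.mul_const X).mul hN.tendsto_flow

/-- The homogeneous Sylvester equation with Hurwitz coefficients has only the zero solution. -/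
theorem sylvester_eq_zero {M N X : Matrix ι ι ℝ} (hM : IsHurwitz M) (hN : IsHurwitz N)
    (h : M * X + X * N = 0) : X = 0 := by
  have hd : ∀ t, HasDerivAt (fun t => flow M t * X * flow N t) 0 t := fun t => by
    simpa [h] using hasDerivAt_flow_conj M N X t
  have hc : ∀ t, flow M t * X * flow N t = X := fun t => by
    simpa [flow_zero] using
      is_const_of_deriv_eq_zero (fun t => (hd t).differentiableAt) (fun t => (hd t).deriv) t 0
  refine tendsto_nhds_unique ?_ (tendsto_flow_conj hM hN X)
  simp only [hc]
  exact tendsto_const_nhds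

/-- The quadratic form of `X` decreases to zero along the flow of `M`, so it is nonnegative. -/
theorem posSemidef_of_lyapunov {M X Q : Matrix ι ι ℝ} (hM : IsHurwitz M) (hX : Xᵀ = X)
    (hQ : Q.PosSemidef) (h : Mᵀ * X + X * M + Q = 0) : X.PosSemidef := by
  refine posSemidef_iff_real.2 ⟨hX, fun x => ?_⟩
  let L : Matrix ι ι ℝ →L[ℝ] ℝ := LinearMap.toContinuousLinearMap
    { toFun := fun N => x ⬝ᵥ N *ᵥ x
      map_add' := fun N N' => by simp [Matrix.add_mulVec]
      map_smul' := fun c N => by simp [Matrix.smul_mulVec] }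
  have hL : ∀ N, L N = x ⬝ᵥ N *ᵥ x := fun _ => rfl
  have hd : ∀ t, HasDerivAt (fun t => L (flow Mᵀ t * X * flow M t))
      (-(x ⬝ᵥ ((flow M t)ᵀ * Q * flow M t) *ᵥ x)) t := by
    intro t
    have := L.hasFDerivAt.comp_hasDerivAt t (hasDerivAt_flow_conj Mᵀ M X t)
    convert! this using 1
    rw [eq_neg_of_add_eq_zero_left h, flow_transpose]
    rw [Matrix.mul_neg, Matrix.neg_mul]
    refine Eq.trans ?_ (hL _).symm
    rw [Matrix.neg_mulVec, dotProduct_neg]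
  have hanti : Antitone (fun t => L (flow Mᵀ t * X * flow M t)) := by
    refine antitone_of_deriv_nonpos (fun t => (hd t).differentiableAt) fun t => ?_
    rw [(hd t).deriv, neg_nonpos]
    exact (posSemidef_iff_real.1 (posSemidef_transpose_mul_mul hQ _)).2 x
  have hlim : Tendsto (fun t => L (flow Mᵀ t * X * flow M t)) atTop (𝓝 0) := by
    rw [← map_zero L]
    exact (L.continuous.tendsto _).comp (tendsto_flow_conj hM.transpose hM X)
  have := hanti.le_of_tendsto hlim 0
  simpa [flow_zero, hL] using this

end

theorem exists_lyapunov {M Q : Matrix ι ι ℝ} (hM : IsHurwitz M) (hQ : Q.PosSemidef) :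
    ∃ X : Matrix ι ι ℝ, X.PosSemidef ∧ Mᵀ * X + X * M + Q = 0 := by
  let L : Matrix ι ι ℝ →ₗ[ℝ] Matrix ι ι ℝ :=
    LinearMap.mulLeft ℝ Mᵀ + LinearMap.mulRight ℝ M
  have hL : ∀ X, L X = Mᵀ * X + X * M := fun X => rfl
  have hinj : Function.Injective L := by
    rw [← LinearMap.ker_eq_bot, LinearMap.ker_eq_bot']
    intro X hX
    exact sylvester_eq_zero hM.transpose hM hX
  obtain ⟨X, hX⟩ := LinearMap.injective_iff_surjective.1 hinj (-Q)
  rw [hL] at hX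
  have hQs := (posSemidef_iff_real.1 hQ).1
  have hsymm : Xᵀ = X := by
    refine hinj ?_
    rw [hL, hL, hX, ← hQs, ← Matrix.transpose_neg, ← hX]
    simp [add_comm]
  have h0 : Mᵀ * X + X * M + Q = 0 := by rw [hX, neg_add_cancel]
  exact ⟨X, posSemidef_of_lyapunov hM hsymm hQ h0, h0⟩

end Lyapunov

section Riccati

variable {ι κ : Type*} [Fintype ι] [Fintype κ]

/-- The Hautus form of detectability for the pair `(A, Q)`: no eigenvector of `A` for an
eigenvalue with nonnegative real part is annihilated by `Q`. -/
def IsHautusDetectable (A Q : Matrix ι ι ℝ) : Prop :=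
  ∀ σ ω a b, 0 ≤ σ → IsEigenpair A σ ω a b → Q *ᵥ a = 0 → Q *ᵥ b = 0 → a = 0 ∧ b = 0

theorem IsDetectable.isHautusDetectable [DecidableEq ι] {A : Matrix ι ι ℝ} {F : Matrix κ ι ℝ}
    (h : IsDetectable A F) : IsHautusDetectable A (Fᵀ * F) := by
  obtain ⟨L, hL⟩ := h
  intro σ ω a b hσ hab ha hb
  have hF : ∀ v, (Fᵀ * F) *ᵥ v = 0 → F *ᵥ v = 0 := by
    intro v hv
    have : (F *ᵥ v) ⬝ᵥ (F *ᵥ v) = 0 := by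
      rw [← Matrix.transpose_transpose F, ← dotProduct_mulVec_transpose,
        Matrix.transpose_transpose, Matrix.mulVec_mulVec, hv, dotProduct_zero]
    exact dotProduct_self_eq_zero.1 this
  refine isHurwitz_iff.1 hL σ ω a b hσ ⟨?_, ?_⟩
  · rw [Matrix.add_mulVec, ← Matrix.mulVec_mulVec, hF a ha, Matrix.mulVec_zero, add_zero, hab.1]
  · rw [Matrix.add_mulVec, ← Matrix.mulVec_mulVec, hF b hb, Matrix.mulVec_zero, add_zero, hab.2]

/-- The closed-loop Lyapunov equation for the feedback `K`, rewritten for the improved feedback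
`K' = -R⁻¹ Bᵀ Y`. -/
theorem kleinman_identity {A Q Y : Matrix ι ι ℝ} {B : Matrix ι κ ℝ} {R : Matrix κ κ ℝ}
    {K K' : Matrix κ ι ℝ} (hR : Rᵀ = R) (hY : Yᵀ = Y) (hK' : R * K' = -(Bᵀ * Y)) :
    (A + B * K)ᵀ * Y + Y * (A + B * K) + (Q + Kᵀ * R * K) =
      (A + B * K')ᵀ * Y + Y * (A + B * K') +
        (Q + K'ᵀ * R * K' + (K - K')ᵀ * R * (K - K')) := by
  have h1 : Bᵀ * Y = -(R * K') := by rw [hK', neg_neg]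
  have h2 : Y * B = -(K'ᵀ * R) := by
    have := congr_arg Matrix.transpose h1
    simpa [hY, hR] using this
  simp only [Matrix.transpose_add, Matrix.transpose_mul, Matrix.transpose_sub, Matrix.add_mul,
    Matrix.mul_add, Matrix.sub_mul, Matrix.mul_sub, Matrix.mul_assoc, h1]
  simp only [← Matrix.mul_assoc, h2]
  simp only [Matrix.mul_neg, Matrix.neg_mul, Matrix.mul_assoc]
  abel

variable [DecidableEq ι]

theorem isHurwitz_of_lyapunov_improved {A Q Y : Matrix ι ι ℝ} {B : Matrix ι κ ℝ}
    {R : Matrix κ κ ℝ} {K K' : Matrix κ ι ℝ} (hR : R.PosDef) (hQ : Q.PosSemidef)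
    (hY : Y.PosSemidef) (hK : IsHurwitz (A + B * K)) (hK' : R * K' = -(Bᵀ * Y))
    (h : (A + B * K)ᵀ * Y + Y * (A + B * K) + (Q + Kᵀ * R * K) = 0) :
    IsHurwitz (A + B * K') := by
  obtain ⟨hRs, hRp⟩ := posDef_iff_real.1 hR
  have hYr := posSemidef_iff_real.1 hY
  have hQr := posSemidef_iff_real.1 hQ
  rw [kleinman_identity hRs hYr.1 hK'] at h
  refine isHurwitz_iff.2 fun σ ω a b hσ hab => ?_
  have h0 := hab.lyapunov hYr.1 h
  simp only [Matrix.add_mulVec, dotProduct_add, dotProduct_transpose_mul_mul] at h0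
  have hRn := (posSemidef_iff_real.1 hR.posSemidef).2
  have p1 : 0 ≤ 2 * σ * (a ⬝ᵥ Y *ᵥ a + b ⬝ᵥ Y *ᵥ b) :=
    mul_nonneg (by linarith) (add_nonneg (hYr.2 a) (hYr.2 b))
  have p2 := hQr.2 a
  have p3 := hQr.2 b
  have p4 := hRn (K' *ᵥ a)
  have p5 := hRn (K' *ᵥ b)
  have p6 := hRn ((K - K') *ᵥ a)
  have p7 := hRn ((K - K') *ᵥ b)
  have z : ∀ v, ((K - K') *ᵥ v) ⬝ᵥ R *ᵥ ((K - K') *ᵥ v) = 0 → (A + B * K) *ᵥ v =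
      (A + B * K') *ᵥ v := by
    intro v hv
    have hz : (K - K') *ᵥ v = 0 := by
      by_contra hne
      exact (hRp hne).ne' hv
    rw [Matrix.sub_mulVec, sub_eq_zero] at hz
    rw [Matrix.add_mulVec, Matrix.add_mulVec, ← Matrix.mulVec_mulVec, ← Matrix.mulVec_mulVec, hz]
  refine isHurwitz_iff.1 hK σ ω a b hσ ⟨?_, ?_⟩
  · rw [z a (by linarith), hab.1]
  · rw [z b (by linarith), hab.2]

/-- A sequence of real symmetric matrices which decreases and is bounded below in the Loewner
order converges. -/
theorem exists_tendsto_of_posSemidef_sub {Y : ℕ → Matrix ι ι ℝ} (h0 : ∀ k, (Y k).PosSemidef)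
    (h1 : ∀ k, (Y k - Y (k + 1)).PosSemidef) :
    ∃ P : Matrix ι ι ℝ, Tendsto Y atTop (𝓝 P) := by
  have hq : ∀ x, ∃ l : ℝ, Tendsto (fun k => x ⬝ᵥ Y k *ᵥ x) atTop (𝓝 l) := by
    intro x
    have hanti : Antitone fun k => x ⬝ᵥ Y k *ᵥ x := by
      refine antitone_nat_of_succ_le fun k => ?_
      have := (posSemidef_iff_real.1 (h1 k)).2 x
      rw [Matrix.sub_mulVec, dotProduct_sub] at this
      linarith
    refine ⟨_, tendsto_atTop_ciInf hanti ⟨0, ?_⟩⟩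
    rintro _ ⟨k, rfl⟩
    exact (posSemidef_iff_real.1 (h0 k)).2 x
  choose q hq using hq
  refine ⟨fun i j => (q (Pi.single i 1 + Pi.single j 1) - q (Pi.single i 1) -
    q (Pi.single j 1)) / 2, ?_⟩
  refine tendsto_pi_nhds.2 fun i => tendsto_pi_nhds.2 fun j => ?_
  refine ((((hq (Pi.single i 1 + Pi.single j 1)).sub (hq (Pi.single i 1))).sub
    (hq (Pi.single j 1))).div_const 2).congr fun k => ?_
  have hs : Y k j i = Y k i j := congr_fun (congr_fun (posSemidef_iff_real.1 (h0 k)).1 i) j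
  simp [Matrix.mulVec_add, hs]
  ring

variable [DecidableEq κ]

/-- Existence for the algebraic Riccati equation, as the limit of Kleinman's iteration: each
feedback is replaced by the optimal one for the cost matrix of the previous closed loop. -/
theorem exists_riccati {A Q : Matrix ι ι ℝ} {B : Matrix ι κ ℝ} {R : Matrix κ κ ℝ}
    (hR : R.PosDef) (hQ : Q.PosSemidef) (hst : IsStabilizable A B) :
    ∃ P : Matrix ι ι ℝ, P.PosSemidef ∧ P * A + Aᵀ * P - P * (B * R⁻¹ * Bᵀ) * P + Q = 0 := by
  obtain ⟨K₀, hK₀⟩ := hst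
  have hRs := (posDef_iff_real.1 hR).1
  have hRu : IsUnit R.det := (Matrix.isUnit_iff_isUnit_det _).1 hR.isUnit
  have hRi : R⁻¹ᵀ = R⁻¹ := by rw [Matrix.transpose_nonsing_inv, hRs]
  have hex : ∀ K : {K : Matrix κ ι ℝ // IsHurwitz (A + B * K)}, ∃ Y : Matrix ι ι ℝ,
      Y.PosSemidef ∧ (A + B * K.1)ᵀ * Y + Y * (A + B * K.1) + (Q + K.1ᵀ * R * K.1) = 0 :=
    fun K => exists_lyapunov K.2 (hQ.add (posSemidef_transpose_mul_mul hR.posSemidef _))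
  choose Y hY hYeq using hex
  have himp : ∀ Y : Matrix ι ι ℝ, R * (-(R⁻¹ * Bᵀ * Y)) = -(Bᵀ * Y) := by
    intro Y
    rw [Matrix.mul_neg, Matrix.mul_assoc, Matrix.mul_nonsing_inv_cancel_left _ _ hRu]
  let next : {K : Matrix κ ι ℝ // IsHurwitz (A + B * K)} →
      {K : Matrix κ ι ℝ // IsHurwitz (A + B * K)} := fun K =>
    ⟨-(R⁻¹ * Bᵀ * Y K), isHurwitz_of_lyapunov_improved hR hQ (hY K) K.2 (himp _) (hYeq K)⟩
  let K : ℕ → {K : Matrix κ ι ℝ // IsHurwitz (A + B * K)} := fun k => next^[k] ⟨K₀, hK₀⟩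
  have hKsucc : ∀ k, (K (k + 1)).1 = -(R⁻¹ * Bᵀ * Y (K k)) := by
    intro k
    simp only [K, Function.iterate_succ_apply']
    rfl
  have hdecr : ∀ k, (Y (K k) - Y (K (k + 1))).PosSemidef := by
    intro k
    have e1 := hYeq (K k)
    have e2 := hYeq (K (k + 1))
    rw [kleinman_identity (K' := (K (k + 1)).1) hRs (posSemidef_iff_real.1 (hY (K k))).1
      (by rw [hKsucc, himp])] at e1
    refine posSemidef_of_lyapunov (K (k + 1)).2 ?_
      (posSemidef_transpose_mul_mul hR.posSemidef ((K k).1 - (K (k + 1)).1)) ?_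
    · rw [Matrix.transpose_sub, (posSemidef_iff_real.1 (hY _)).1,
        (posSemidef_iff_real.1 (hY _)).1]
    · rw [← sub_eq_zero.2 (e1.trans e2.symm)]
      simp only [Matrix.mul_sub, Matrix.sub_mul]
      abel
  obtain ⟨P, hP⟩ := exists_tendsto_of_posSemidef_sub (fun k => hY (K k)) hdecr
  have hPps : P.PosSemidef := by
    refine posSemidef_iff_real.2 ⟨?_, fun x => ?_⟩
    · refine tendsto_nhds_unique ((continuous_id.matrix_transpose.tendsto P).comp hP) ?_
      exact hP.congr fun k => (posSemidef_iff_real.1 (hY (K k))).1.symm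
    · have hc : Continuous fun N : Matrix ι ι ℝ => x ⬝ᵥ N *ᵥ x :=
        continuous_const.dotProduct (continuous_id.matrix_mulVec continuous_const)
      exact ge_of_tendsto' ((hc.tendsto P).comp hP)
        fun k => (posSemidef_iff_real.1 (hY (K k))).2 x
  refine ⟨P, hPps, ?_⟩
  have hPs := (posSemidef_iff_real.1 hPps).1
  let G : Matrix ι ι ℝ × Matrix ι ι ℝ → Matrix ι ι ℝ := fun p =>
    (A + B * (-(R⁻¹ * Bᵀ * p.1)))ᵀ * p.2 + p.2 * (A + B * (-(R⁻¹ * Bᵀ * p.1))) +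
      (Q + (-(R⁻¹ * Bᵀ * p.1))ᵀ * R * (-(R⁻¹ * Bᵀ * p.1)))
  have hG : Continuous G := by
    fun_prop
  have hlim : Tendsto (fun k => G (Y (K k), Y (K (k + 1)))) atTop (𝓝 (G (P, P))) :=
    (hG.tendsto _).comp (hP.prodMk_nhds (hP.comp (tendsto_add_atTop_nat 1)))
  have hzero : ∀ k, G (Y (K k), Y (K (k + 1))) = 0 := by
    intro k
    have := hYeq (K (k + 1))
    rwa [hKsucc] at this
  have hGP : G (P, P) = 0 := by
    refine tendsto_nhds_unique hlim ?_
    simp only [hzero]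
    exact tendsto_const_nhds
  rw [← hGP]
  simp only [G, Matrix.transpose_add, Matrix.transpose_mul, Matrix.transpose_neg, hPs, hRi,
    Matrix.transpose_transpose, Matrix.mul_neg, Matrix.neg_mul, Matrix.add_mul, Matrix.mul_add,
    neg_neg, Matrix.mul_assoc, Matrix.nonsing_inv_mul_cancel_left _ _ hRu]
  abel

variable {A Q : Matrix ι ι ℝ} {B : Matrix ι κ ℝ} {R : Matrix κ κ ℝ}

/-- A positive semidefinite solution of the Riccati equation of a detectable system is
stabilizing. -/
theorem isHurwitz_of_riccati (hR : R.PosDef) (hQ : Q.PosSemidef) (hdet : IsHautusDetectable A Q)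
    {P : Matrix ι ι ℝ} (hP : P.PosSemidef)
    (h : P * A + Aᵀ * P - P * (B * R⁻¹ * Bᵀ) * P + Q = 0) :
    IsHurwitz (A - B * R⁻¹ * Bᵀ * P) := by
  have hPr := posSemidef_iff_real.1 hP
  have hQr := posSemidef_iff_real.1 hQ
  have hRi := posDef_iff_real.1 hR.inv
  have hRn := (posSemidef_iff_real.1 hR.inv.posSemidef).2
  have hW : (A - B * R⁻¹ * Bᵀ * P)ᵀ * P + P * (A - B * R⁻¹ * Bᵀ * P) +
      (Q + (Bᵀ * P)ᵀ * R⁻¹ * (Bᵀ * P)) = 0 := by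
    rw [← h]
    simp only [Matrix.transpose_sub, Matrix.transpose_mul, Matrix.transpose_transpose, hPr.1,
      hRi.1, Matrix.sub_mul, Matrix.mul_sub, Matrix.mul_assoc]
    abel
  refine isHurwitz_iff.2 fun σ ω a b hσ hab => ?_
  have h0 := hab.lyapunov hPr.1 hW
  simp only [Matrix.add_mulVec, dotProduct_add, dotProduct_transpose_mul_mul] at h0
  have p1 : 0 ≤ 2 * σ * (a ⬝ᵥ P *ᵥ a + b ⬝ᵥ P *ᵥ b) :=
    mul_nonneg (by linarith) (add_nonneg (hPr.2 a) (hPr.2 b))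
  have p2 := hQr.2 a
  have p3 := hQr.2 b
  have p4 := hRn ((Bᵀ * P) *ᵥ a)
  have p5 := hRn ((Bᵀ * P) *ᵥ b)
  have zQ : ∀ v, v ⬝ᵥ Q *ᵥ v = 0 → Q *ᵥ v = 0 := fun v hv =>
    (hQ.dotProduct_mulVec_zero_iff v).1 (by simpa using hv)
  have zR : ∀ v, ((Bᵀ * P) *ᵥ v) ⬝ᵥ R⁻¹ *ᵥ ((Bᵀ * P) *ᵥ v) = 0 →
      (A - B * R⁻¹ * Bᵀ * P) *ᵥ v = A *ᵥ v := by
    intro v hv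
    have hz : (Bᵀ * P) *ᵥ v = 0 := by
      by_contra hne
      exact (hRi.2 hne).ne' hv
    rw [Matrix.sub_mulVec, Matrix.mul_assoc _ Bᵀ, ← Matrix.mulVec_mulVec, hz, Matrix.mulVec_zero,
      sub_zero]
  refine hdet σ ω a b hσ ⟨?_, ?_⟩ (zQ a (by linarith)) (zQ b (by linarith))
  · rw [← zR a (by linarith), hab.1]
  · rw [← zR b (by linarith), hab.2]

theorem riccati_unique (hR : R.PosDef) (hQ : Q.PosSemidef) (hdet : IsHautusDetectable A Q)
    {P P' : Matrix ι ι ℝ} (hP : P.PosSemidef) (hP' : P'.PosSemidef)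
    (h : P * A + Aᵀ * P - P * (B * R⁻¹ * Bᵀ) * P + Q = 0)
    (h' : P' * A + Aᵀ * P' - P' * (B * R⁻¹ * Bᵀ) * P' + Q = 0) : P' = P := by
  have hRi := posDef_iff_real.1 hR.inv
  have hPs := (posSemidef_iff_real.1 hP).1
  rw [← sub_eq_zero]
  refine sylvester_eq_zero (isHurwitz_of_riccati hR hQ hdet hP h).transpose
    (isHurwitz_of_riccati hR hQ hdet hP' h') ?_
  rw [← sub_eq_zero.2 (h'.trans h.symm)]
  simp only [Matrix.transpose_sub, Matrix.transpose_mul, Matrix.transpose_transpose, hPs,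
    hRi.1, Matrix.sub_mul, Matrix.mul_sub, Matrix.mul_assoc]
  abel

end Riccati

/-! ### Linear differential equations with square integrable inputs -/

/-- Square integrability on the half-line `(0, +∞)`. -/
abbrev IsL2 {E : Type*} [NormedAddCommGroup E] (x : ℝ → E) : Prop :=
  MemLp x 2 (volume.restrict (Ioi (0 : ℝ)))

section L2

variable {ι κ : Type*} [Fintype ι] [Fintype κ]

theorem IsL2.mulVec {x : ℝ → ι → ℝ} (hx : IsL2 x) (M : Matrix κ ι ℝ) :
    IsL2 fun t => M *ᵥ x t :=
  (LinearMap.toContinuousLinearMap M.mulVecLin).comp_memLp' hx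

theorem IsL2.add {E : Type*} [NormedAddCommGroup E] {x y : ℝ → E} (hx : IsL2 x) (hy : IsL2 y) :
    IsL2 fun t => x t + y t :=
  MemLp.add hx hy

theorem IsL2.sub {E : Type*} [NormedAddCommGroup E] {x y : ℝ → E} (hx : IsL2 x) (hy : IsL2 y) :
    IsL2 fun t => x t - y t :=
  MemLp.sub hx hy

theorem IsL2.neg {E : Type*} [NormedAddCommGroup E] {x : ℝ → E} (hx : IsL2 x) :
    IsL2 fun t => -x t :=
  MemLp.neg hx

theorem IsL2.integrable_dotProduct {x y : ℝ → ι → ℝ} (hx : IsL2 x) (hy : IsL2 y) :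
    IntegrableOn (fun t => x t ⬝ᵥ y t) (Ioi 0) :=
  integrable_finsetSum _ fun i _ => (hx.eval i).integrable_mul (hy.eval i)

theorem IsL2.intervalIntegrable {E : Type*} [NormedAddCommGroup E] {x : ℝ → E} (hx : IsL2 x)
    {t : ℝ} (ht : 0 ≤ t) : IntervalIntegrable x volume 0 t := by
  rw [intervalIntegrable_iff_integrableOn_Ioc_of_le ht]
  have : MemLp x 2 (volume.restrict (Ioc 0 t)) :=
    hx.mono_measure (Measure.restrict_mono Ioc_subset_Ioi_self le_rfl)
  exact this.integrable one_le_two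

theorem isL2_of_integrable {x : ℝ → ι → ℝ}
    (hm : AEStronglyMeasurable x (volume.restrict (Ioi (0 : ℝ))))
    (h : IntegrableOn (fun t => x t ⬝ᵥ x t) (Ioi 0)) : IsL2 x := by
  refine MemLp.of_eval fun i => ?_
  have hmi : AEStronglyMeasurable (fun t => x t i) (volume.restrict (Ioi (0 : ℝ))) :=
    (continuous_apply i).comp_aestronglyMeasurable hm
  refine (memLp_two_iff_integrable_sq hmi).2 (h.mono' (hmi.pow 2) (ae_of_all _ fun t => ?_))
  rw [Real.norm_of_nonneg (sq_nonneg _), sq]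
  exact Finset.single_le_sum (f := fun i => x t i * x t i) (fun j _ => mul_self_nonneg _)
    (Finset.mem_univ i)

theorem aestronglyMeasurable_of_continuousOn {E : Type*} [NormedAddCommGroup E]
    {x : ℝ → E} (h : ContinuousOn x (Ici 0)) :
    AEStronglyMeasurable x (volume.restrict (Ioi (0 : ℝ))) :=
  (h.mono Ioi_subset_Ici_self).aestronglyMeasurable measurableSet_Ioi

theorem isL2_exp {γ : ℝ} (hγ : 0 < γ) : IsL2 fun t : ℝ => Real.exp (-γ * t) := by
  refine (memLp_two_iff_integrable_sq
    (by fun_prop : Continuous fun t : ℝ => Real.exp (-γ * t)).aestronglyMeasurable).2 ?_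
  have := integrableOn_exp_mul_Ioi (a := -(2 * γ)) (by linarith) 0
  refine this.congr_fun (fun t _ => ?_) measurableSet_Ioi
  simp only
  rw [← Real.exp_nat_mul]
  congr 1
  push_cast
  ring

theorem isL2_of_exp_bound {E : Type*} [NormedAddCommGroup E] {x : ℝ → E} {C γ : ℝ}
    (hγ : 0 < γ) (hm : AEStronglyMeasurable x (volume.restrict (Ioi (0 : ℝ))))
    (h : ∀ t, 0 ≤ t → ‖x t‖ ≤ C * Real.exp (-γ * t)) : IsL2 x := by
  refine ((isL2_exp hγ).const_mul C).of_le hm ?_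
  refine (ae_restrict_mem measurableSet_Ioi).mono fun t ht => ?_
  exact (h t (le_of_lt ht)).trans (le_abs_self _)

theorem dotProduct_self_nonneg (v : ι → ℝ) : 0 ≤ v ⬝ᵥ v :=
  Finset.sum_nonneg fun _ _ => mul_self_nonneg _

theorem exists_quadratic_bound (N : Matrix ι ι ℝ) :
    ∃ c : ℝ, 0 ≤ c ∧ ∀ v : ι → ℝ, v ⬝ᵥ N *ᵥ v ≤ c * (v ⬝ᵥ v) := by
  refine ⟨∑ i, ∑ j, |N i j|, by positivity, fun v => ?_⟩
  have hle : ∀ i, v i * v i ≤ v ⬝ᵥ v := fun i =>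
    Finset.single_le_sum (f := fun i => v i * v i) (fun j _ => mul_self_nonneg _)
      (Finset.mem_univ i)
  simp only [Finset.sum_mul]
  rw [dotProduct]
  refine Finset.sum_le_sum fun i _ => ?_
  rw [mulVec, dotProduct, Finset.mul_sum]
  refine Finset.sum_le_sum fun j _ => ?_
  calc v i * (N i j * v j) = N i j * (v i * v j) := by ring
    _ ≤ |N i j| * |v i * v j| := by rw [← abs_mul]; exact le_abs_self _
    _ ≤ |N i j| * (v ⬝ᵥ v) := by
      refine mul_le_mul_of_nonneg_left ?_ (abs_nonneg _)
      have h1 := hle i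
      have h2 := hle j
      rw [abs_le]
      constructor <;> nlinarith [sq_nonneg (v i - v j), sq_nonneg (v i + v j)]

theorem exists_mulVec_sq_bound (N : Matrix κ ι ℝ) :
    ∃ c : ℝ, 0 ≤ c ∧ ∀ v : ι → ℝ, (N *ᵥ v) ⬝ᵥ (N *ᵥ v) ≤ c * (v ⬝ᵥ v) := by
  obtain ⟨c, hc, h⟩ := exists_quadratic_bound (Nᵀ * N)
  refine ⟨c, hc, fun v => ?_⟩
  have := h v
  rwa [← Matrix.mulVec_mulVec, dotProduct_mulVec_transpose, Matrix.transpose_transpose] at this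

end L2

section LinearODE

variable {ι : Type*} [Fintype ι] [DecidableEq ι]

section

open scoped Matrix.Norms.Operator

theorem hasDerivAt_flow_apply (M : Matrix ι ι ℝ) (i j : ι) (t : ℝ) :
    HasDerivAt (fun t => flow M t i j) ((M * flow M t) i j) t :=
  hasDerivAt_apply (hasDerivAt_flow M t) i j

theorem continuous_flow_apply (M : Matrix ι ι ℝ) (i j : ι) : Continuous fun t => flow M t i j :=
  continuous_iff_continuousAt.2 fun t => (hasDerivAt_flow_apply M i j t).continuousAt

theorem continuous_mul_flow_apply (M : Matrix ι ι ℝ) (i j : ι) :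
    Continuous fun t => (M * flow M t) i j := by
  simp only [Matrix.mul_apply]
  exact continuous_finsetSum _ fun k _ => continuous_const.mul (continuous_flow_apply M k j)

theorem flow_neg (M : Matrix ι ι ℝ) (t : ℝ) : flow (-M) t = flow M (-t) := by
  simp [flow]

end

theorem IsPrimitive.flow_mulVec (M : Matrix ι ι ℝ) {a x : ℝ → ι → ℝ} (h : IsPrimitive a x) :
    IsPrimitive (fun t => M *ᵥ flow M t *ᵥ x t + flow M t *ᵥ a t) (fun t => flow M t *ᵥ x t) := by
  simpa only [Matrix.mulVec_mulVec] using
    h.mulVec_of_hasDerivAt (hasDerivAt_flow_apply M) (continuous_mul_flow_apply M)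

/-- Variation of constants. -/
theorem IsPrimitive.variation_of_constants {M : Matrix ι ι ℝ} {g c : ℝ → ι → ℝ}
    (h : IsPrimitive (fun t => flow M (-t) *ᵥ g t) c) :
    IsPrimitive (fun t => M *ᵥ flow M t *ᵥ c t + g t) (fun t => flow M t *ᵥ c t) :=
  (h.flow_mulVec M).congr_deriv fun t _ => by
    rw [Matrix.mulVec_mulVec (g t), flow_mul_neg, Matrix.one_mulVec]

theorem intervalIntegrable_flow_mulVec (M : Matrix ι ι ℝ) {g : ℝ → ι → ℝ} {t : ℝ} (ht : 0 ≤ t)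
    (hg : IntervalIntegrable g volume 0 t) :
    IntervalIntegrable (fun s => flow M s *ᵥ g s) volume 0 t := by
  have hg' := (intervalIntegrable_iff_integrableOn_Ioc_of_le ht).1 hg
  refine (intervalIntegrable_iff_integrableOn_Ioc_of_le ht).2 (Integrable.of_eval fun i => ?_)
  refine (intervalIntegrable_iff_integrableOn_Ioc_of_le ht).1 ?_
  have : ∀ j ∈ Finset.univ, IntervalIntegrable (fun s => flow M s i j * g s j) volume 0 t :=
    fun j _ => ((intervalIntegrable_iff_integrableOn_Ioc_of_le ht).2
      (Integrable.eval hg' j)).continuousOn_mul (continuous_flow_apply M i j).continuousOn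
  have h2 := IntervalIntegrable.sum Finset.univ this
  refine h2.congr fun s _ => ?_
  simp [Matrix.mulVec, dotProduct]

theorem exists_linear_solution (M : Matrix ι ι ℝ) (x₀ : ι → ℝ) {g : ℝ → ι → ℝ}
    (hg : ∀ t, 0 ≤ t → IntervalIntegrable g volume 0 t) :
    ∃ x : ℝ → ι → ℝ, x 0 = x₀ ∧ IsPrimitive (fun t => M *ᵥ x t + g t) x := by
  have hc := IsPrimitive.of_integral (a := fun t => flow M (-t) *ᵥ g t) x₀ fun t ht => by
    simpa only [flow_neg] using intervalIntegrable_flow_mulVec (-M) ht (hg t ht)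
  exact ⟨_, by simp [flow_zero], hc.variation_of_constants⟩

theorem eq_flow_of_homogeneous {M : Matrix ι ι ℝ} {x : ℝ → ι → ℝ}
    (h : IsPrimitive (fun t => M *ᵥ x t) x) {t : ℝ} (ht : 0 ≤ t) : x t = flow M t *ᵥ x 0 := by
  have h0 := (h.flow_mulVec (-M)).eq_of_deriv_zero (fun t _ => by
    rw [Matrix.mulVec_mulVec, Matrix.mulVec_mulVec, commute_flow, Matrix.mul_neg,
      Matrix.neg_mulVec, neg_add_cancel]) ht
  simp only [flow_zero, Matrix.one_mulVec] at h0
  rw [← h0, Matrix.mulVec_mulVec, flow_neg, flow_mul_neg, Matrix.one_mulVec]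

theorem linear_solution_unique {M : Matrix ι ι ℝ} {g x y : ℝ → ι → ℝ}
    (hx : IsPrimitive (fun t => M *ᵥ x t + g t) x) (hy : IsPrimitive (fun t => M *ᵥ y t + g t) y)
    (h0 : x 0 = y 0) : EqOn x y (Ici 0) := by
  intro t ht
  have h := (hx.sub hy).congr_deriv (b := fun t => M *ᵥ (x t - y t)) fun t _ => by
    rw [Matrix.mulVec_sub]
    abel
  have := eq_flow_of_homogeneous h ht
  rw [h0, sub_self, Matrix.mulVec_zero] at this
  exact sub_eq_zero.1 this

/-- Input-to-state stability in the mean square: the quadratic Lyapunov function of a Hurwitz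
matrix bounds the energy of every solution by the energy of the input and the initial value. -/
theorem IsHurwitz.exists_l2_bound {M : Matrix ι ι ℝ} (hM : IsHurwitz M) :
    ∃ C : ℝ, 0 ≤ C ∧ ∀ x g : ℝ → ι → ℝ, IsPrimitive (fun t => M *ᵥ x t + g t) x → IsL2 g →
      IsL2 x ∧ ∫ t in Ioi (0 : ℝ), x t ⬝ᵥ x t ≤
        C * (x 0 ⬝ᵥ x 0 + ∫ t in Ioi (0 : ℝ), g t ⬝ᵥ g t) := by
  obtain ⟨X, hXp, hX⟩ := exists_lyapunov hM Matrix.PosSemidef.one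
  obtain ⟨hXs, hXn⟩ := posSemidef_iff_real.1 hXp
  obtain ⟨c₁, hc₁, h₁⟩ := exists_quadratic_bound X
  obtain ⟨c₂, hc₂, h₂⟩ := exists_mulVec_sq_bound X
  refine ⟨2 * c₁ + 4 * c₂, by positivity, fun x g hx hg => ?_⟩
  have hgg := hg.integrable_dotProduct hg
  have hgg0 : 0 ≤ ∫ t in Ioi (0 : ℝ), g t ⬝ᵥ g t :=
    integral_nonneg fun t => dotProduct_self_nonneg _
  have hxx0 : ∀ t, 0 ≤ x t ⬝ᵥ x t := fun t => dotProduct_self_nonneg _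
  have hV := hx.dotProduct (hx.mulVec X)
  have hV' := hV.congr_deriv (b := fun t => -(x t ⬝ᵥ x t) + 2 * (x t ⬝ᵥ X *ᵥ g t)) fun t _ => by
    have h0 := congr_arg (fun N => x t ⬝ᵥ N *ᵥ x t) hX
    simp only [Matrix.add_mulVec, dotProduct_add, Matrix.zero_mulVec, dotProduct_zero,
      Matrix.one_mulVec] at h0
    rw [← Matrix.mulVec_mulVec, ← Matrix.mulVec_mulVec, dotProduct_mulVec_transpose Mᵀ,
      Matrix.transpose_transpose] at h0
    simp only [Matrix.mulVec_add, add_dotProduct, dotProduct_add]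
    rw [dotProduct_mulVec_symm hXs (g t)]
    linarith
  have hxc := hx.continuousOn
  have hxi : ∀ T, 0 ≤ T → IntervalIntegrable (fun t => x t ⬝ᵥ x t) volume 0 T := by
    intro T hT
    refine ContinuousOn.intervalIntegrable ?_
    rw [uIcc_of_le hT]
    have : ContinuousOn (fun t => x t ⬝ᵥ x t) (Ici 0) := (hx.dotProduct hx).continuousOn
    exact this.mono Icc_subset_Ici_self
  have hgi : ∀ T, 0 ≤ T → IntervalIntegrable (fun t => g t ⬝ᵥ g t) volume 0 T := fun T hT =>
    (intervalIntegrable_iff_integrableOn_Ioc_of_le hT).2 (hgg.mono_set Ioc_subset_Ioi_self)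
  have hbound : ∀ T, 0 ≤ T → ∫ t in (0 : ℝ)..T, x t ⬝ᵥ x t ≤
      (2 * c₁ + 4 * c₂) * (x 0 ⬝ᵥ x 0 + ∫ t in Ioi (0 : ℝ), g t ⬝ᵥ g t) := by
    intro T hT
    have e := hV'.eq hT
    have hTn := hXn (x T)
    have h0 := h₁ (x 0)
    have hint : ∫ t in (0 : ℝ)..T, (-(x t ⬝ᵥ x t) + 2 * (x t ⬝ᵥ X *ᵥ g t)) ≤
        ∫ t in (0 : ℝ)..T, (-(1 / 2) * (x t ⬝ᵥ x t) + 2 * c₂ * (g t ⬝ᵥ g t)) := by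
      refine intervalIntegral.integral_mono_on hT (hV'.intervalIntegrable hT)
        (((hxi T hT).const_mul _).add ((hgi T hT).const_mul _)) fun t _ => ?_
      -- Young's inequality `2 x·y ≤ x·x / 2 + 2 y·y` with `y = X g`
      have hy := dotProduct_self_nonneg (x t - (2 : ℝ) • X *ᵥ g t)
      simp only [sub_dotProduct, dotProduct_sub, smul_dotProduct, dotProduct_smul,
        smul_eq_mul] at hy
      rw [dotProduct_comm (X *ᵥ g t) (x t)] at hy
      have := h₂ (g t)
      linarith
    rw [intervalIntegral.integral_add ((hxi T hT).const_mul _) ((hgi T hT).const_mul _),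
      intervalIntegral.integral_const_mul, intervalIntegral.integral_const_mul] at hint
    have hgT : ∫ t in (0 : ℝ)..T, g t ⬝ᵥ g t ≤ ∫ t in Ioi (0 : ℝ), g t ⬝ᵥ g t := by
      rw [intervalIntegral.integral_of_le hT]
      exact setIntegral_mono_set hgg (ae_of_all _ fun t => dotProduct_self_nonneg _)
        Ioc_subset_Ioi_self.eventuallyLE
    have := mul_le_mul_of_nonneg_left hgT hc₂
    have := mul_nonneg hc₂ (hxx0 0)
    have := mul_nonneg hc₁ hgg0
    linarith
  have hint : IntegrableOn (fun t => x t ⬝ᵥ x t) (Ioi 0) := by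
    refine integrableOn_Ioi_of_intervalIntegral_norm_bounded _ 0 (b := fun n : ℕ => (n : ℝ))
      (fun n => (intervalIntegrable_iff_integrableOn_Ioc_of_le n.cast_nonneg).1
        (hxi n n.cast_nonneg)) tendsto_natCast_atTop_atTop
      (Eventually.of_forall fun n => (le_of_eq ?_).trans (hbound n n.cast_nonneg))
    refine intervalIntegral.integral_congr fun t _ => ?_
    exact Real.norm_of_nonneg (hxx0 t)
  refine ⟨isL2_of_integrable (aestronglyMeasurable_of_continuousOn hxc) hint, ?_⟩
  refine le_of_tendsto (intervalIntegral_tendsto_integral_Ioi 0 hint tendsto_id) ?_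
  filter_upwards [eventually_ge_atTop (0 : ℝ)] with T hT using hbound T hT

section

open scoped Matrix.Norms.Operator

/-- The backward equation `h' = -N h - f`, `h(+∞) = 0`, with `N` Hurwitz and an exponentially
decaying `f`, has the solution `h(t) = ∫ e^{(s-t)N} f(s) ds` over `s > t`, which decays at the same
rate as `f`. -/
theorem IsHurwitz.exists_backward_solution {N : Matrix ι ι ℝ} (hN : IsHurwitz N)
    {f : ℝ → ι → ℝ} {a γ : ℝ} (hγ : 0 < γ)
    (hm : AEStronglyMeasurable f (volume.restrict (Ioi (0 : ℝ))))
    (hf : ∀ t, 0 ≤ t → ‖f t‖ ≤ a * Real.exp (-γ * t)) :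
    ∃ h : ℝ → ι → ℝ, IsPrimitive (fun t => -(N *ᵥ h t) - f t) h ∧
      ∃ C, ∀ t, 0 ≤ t → ‖h t‖ ≤ C * Real.exp (-γ * t) := by
  obtain ⟨C, α, hC, hα, hflow⟩ := hN.exists_norm_flow_le
  have ha : 0 ≤ a := by
    have := (norm_nonneg _).trans (hf 0 le_rfl)
    simpa using this
  have hfl2 := isL2_of_exp_bound hγ hm hf
  have hfi : ∀ t, 0 ≤ t → IntervalIntegrable f volume 0 t := fun t ht =>
    hfl2.intervalIntegrable ht
  have hmeas : AEStronglyMeasurable (fun s => flow N s *ᵥ f s)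
      (volume.restrict (Ioi (0 : ℝ))) := by
    refine (aemeasurable_pi_iff.2 fun i => ?_).aestronglyMeasurable
    refine Finset.aemeasurable_fun_sum _ fun j _ => ?_
    exact (continuous_flow_apply N i j).measurable.aemeasurable.mul
      ((measurable_pi_apply j).comp_aemeasurable hm.aemeasurable)
  have hint : IntegrableOn (fun s => flow N s *ᵥ f s) (Ioi 0) := by
    refine ((integrableOn_exp_mul_Ioi (a := -α) (by linarith) 0).const_mul (C * a)).mono' hmeas ?_
    refine (ae_restrict_mem measurableSet_Ioi).mono fun s hs => ?_
    have hs' : (0 : ℝ) ≤ s := le_of_lt hs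
    refine (Matrix.linfty_opNorm_mulVec _ _).trans ?_
    have h1 := hflow s hs'
    have h2 : ‖f s‖ ≤ a := (hf s hs').trans (mul_le_of_le_one_right ha
      (Real.exp_le_one_iff.2 (by nlinarith)))
    calc ‖flow N s‖ * ‖f s‖ ≤ (C * Real.exp (-α * s)) * a :=
          mul_le_mul h1 h2 (norm_nonneg _) (by positivity)
      _ = C * a * Real.exp (-α * s) := by ring
  have hc := IsPrimitive.of_integral (a := fun s => -(flow N s *ᵥ f s))
    (∫ s in Ioi (0 : ℝ), flow N s *ᵥ f s) fun t ht =>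
      (intervalIntegrable_flow_mulVec N ht (hfi t ht)).neg
  have hsol := (hc.congr_deriv (b := fun t => flow (-N) (-t) *ᵥ (-f t)) fun t _ => by
    rw [flow_neg, neg_neg, Matrix.mulVec_neg]).variation_of_constants
  refine ⟨_, hsol.congr_deriv fun t _ => by rw [Matrix.neg_mulVec, sub_eq_add_neg],
    C * a / α, fun t ht => ?_⟩
  have hIoi : IntegrableOn (fun s => flow N s *ᵥ f s) (Ioi t) :=
    hint.mono_set (Ioi_subset_Ioi ht)
  have htail : (∫ s in Ioi (0 : ℝ), flow N s *ᵥ f s) + ∫ s in (0 : ℝ)..t, -(flow N s *ᵥ f s) =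
      ∫ s in Ioi t, flow N s *ᵥ f s := by
    rw [intervalIntegral.integral_neg, ← sub_eq_add_neg, sub_eq_iff_eq_add, add_comm,
      intervalIntegral.integral_interval_add_Ioi hint hIoi]
  rw [htail]
  have hpull : flow (-N) t *ᵥ ∫ s in Ioi t, flow N s *ᵥ f s =
      ∫ s in Ioi t, flow N (s - t) *ᵥ f s := by
    have := ((LinearMap.toContinuousLinearMap (flow (-N) t).mulVecLin)).integral_comp_comm hIoi
    refine this.symm.trans ?_
    refine integral_congr_ae (ae_of_all _ fun s => ?_)
    simp only [LinearMap.coe_toContinuousLinearMap', Matrix.mulVecLin_apply]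
    rw [Matrix.mulVec_mulVec, flow_neg, ← flow_add, neg_add_eq_sub]
  rw [hpull]
  have hexp := integrableOn_exp_mul_Ioi (a := -α) (by linarith) t
  refine (norm_integral_le_of_norm_le
    (hexp.const_mul (C * a * Real.exp (-γ * t) * Real.exp (α * t))) ?_).trans ?_
  · refine (ae_restrict_mem measurableSet_Ioi).mono fun s hs => ?_
    have hs' : t < s := hs
    refine (Matrix.linfty_opNorm_mulVec _ _).trans ?_
    have h2 : ‖f s‖ ≤ a * Real.exp (-γ * t) := (hf s (by linarith)).trans
      (mul_le_mul_of_nonneg_left (Real.exp_le_exp.2 (by nlinarith)) ha)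
    calc ‖flow N (s - t)‖ * ‖f s‖
        ≤ (C * Real.exp (-α * (s - t))) * (a * Real.exp (-γ * t)) :=
          mul_le_mul (hflow _ (by linarith)) h2 (norm_nonneg _) (by positivity)
      _ = C * a * Real.exp (-γ * t) * Real.exp (α * t) * Real.exp (-α * s) := by
          have : Real.exp (-α * (s - t)) = Real.exp (α * t) * Real.exp (-α * s) := by
            rw [← Real.exp_add]
            congr 1
            ring
          rw [this]
          ring
  · rw [integral_const_mul, integral_exp_mul_Ioi (by linarith : -α < 0)]
    have : Real.exp (α * t) * Real.exp (-α * t) = 1 := by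
      rw [← Real.exp_add]
      simp
    refine le_of_eq ?_
    calc _ = C * a / α * Real.exp (-γ * t) * (Real.exp (α * t) * Real.exp (-α * t)) := by
          rw [neg_div_neg_eq]
          ring
      _ = C * a / α * Real.exp (-γ * t) := by rw [this, mul_one]

end

theorem backward_solution_unique {N : Matrix ι ι ℝ} (hN : IsHurwitz N) {f h h' : ℝ → ι → ℝ}
    (hh : IsPrimitive (fun t => -(N *ᵥ h t) - f t) h)
    (hh' : IsPrimitive (fun t => -(N *ᵥ h' t) - f t) h')
    (hl : Tendsto h atTop (𝓝 0)) (hl' : Tendsto h' atTop (𝓝 0)) : EqOn h' h (Ici 0) := by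
  have hd := (hh'.sub hh).congr_deriv (b := fun t => (-N) *ᵥ (h' t - h t)) fun t _ => by
    rw [Matrix.neg_mulVec, Matrix.mulVec_sub]
    abel
  have hlim : Tendsto (fun t => h' t - h t) atTop (𝓝 0) := by simpa using hl'.sub hl
  have hc : Continuous fun p : Matrix ι ι ℝ × (ι → ℝ) => p.1 *ᵥ p.2 := by fun_prop
  have h0 : Tendsto (fun t => flow N t *ᵥ (h' t - h t)) atTop (𝓝 0) := by
    have := (hc.tendsto (0, 0)).comp (hN.tendsto_flow.prodMk_nhds hlim)
    simpa using! this
  have hconst : h' 0 - h 0 = 0 := by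
    refine tendsto_nhds_unique ?_ h0
    refine tendsto_const_nhds.congr' ?_
    filter_upwards [eventually_ge_atTop (0 : ℝ)] with t ht
    rw [eq_flow_of_homogeneous hd ht, flow_neg, Matrix.mulVec_mulVec, flow_mul_neg,
      Matrix.one_mulVec]
  intro t ht
  have := eq_flow_of_homogeneous hd ht
  rw [hconst, Matrix.mulVec_zero] at this
  exact sub_eq_zero.1 this

end LinearODE

/-! ### The linear-quadratic problem with a disturbance -/

section LinearQuadratic

variable {ι κ : Type*} [Fintype ι] [Fintype κ] [DecidableEq κ]

/-- The data `(P, h, s)` of the value function `x ↦ xᵀ P x + 2 h(t)ᵀ x + s(t)` of the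
linear-quadratic problem with dynamics `x' = A x + B u + f`, running cost `xᵀ Q x + uᵀ R u` and
`S = B R⁻¹ Bᵀ`: a positive semidefinite solution of the Riccati equation, and solutions of the two
terminal-value problems driven by the disturbance `f`. -/
structure IsValueTriple (A S Q : Matrix ι ι ℝ) (f : ℝ → ι → ℝ)
    (P : Matrix ι ι ℝ) (h : ℝ → ι → ℝ) (s : ℝ → ℝ) : Prop where
  posSemidef : P.PosSemidef
  riccati : P * A + Aᵀ * P - P * S * P + Q = 0
  h_eq : IsPrimitive (fun t => -((A - S * P)ᵀ *ᵥ h t) - P *ᵥ f t) h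
  h_lim : Tendsto h atTop (𝓝 0)
  s_eq : IsPrimitive (fun t => -2 * (h t ⬝ᵥ f t) + h t ⬝ᵥ (S *ᵥ h t)) s
  s_lim : Tendsto s atTop (𝓝 0)

/-- The optimal feedback `-R⁻¹ Bᵀ (P x + h)`. -/
def optimalFeedback (B : Matrix ι κ ℝ) (R : Matrix κ κ ℝ) (P : Matrix ι ι ℝ) (x h : ι → ℝ) :
    κ → ℝ :=
  -(R⁻¹ *ᵥ Bᵀ *ᵥ (P *ᵥ x + h))

variable {A Q P : Matrix ι ι ℝ} {B : Matrix ι κ ℝ} {R : Matrix κ κ ℝ} {f h : ℝ → ι → ℝ}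
  {s : ℝ → ℝ}

theorem eq_zero_of_integrableOn_of_tendsto {g : ℝ → ℝ} {l : ℝ} (hg : IntegrableOn g (Ioi 0))
    (h : Tendsto g atTop (𝓝 l)) : l = 0 := by
  have h1 : IntegrableAtFilter g atTop volume := ⟨Ioi 0, Ioi_mem_atTop 0, hg⟩
  refine h1.eq_zero_of_tendsto (fun s hs => ?_) h
  obtain ⟨b, hb⟩ := mem_atTop_sets.1 hs
  exact measure_mono_top (fun x hx => hb x hx) Real.volume_Ici

/-- Completion of the square in the derivative of the value function along a trajectory. -/
theorem completion_of_square (hR : R.PosDef) (hP : Pᵀ = P)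
    (hric : P * A + Aᵀ * P - P * (B * R⁻¹ * Bᵀ) * P + Q = 0) (x h f : ι → ℝ) (u : κ → ℝ) :
    (A *ᵥ x + B *ᵥ u + f) ⬝ᵥ P *ᵥ x + x ⬝ᵥ P *ᵥ (A *ᵥ x + B *ᵥ u + f) +
      2 * ((-((A - B * R⁻¹ * Bᵀ * P)ᵀ *ᵥ h) - P *ᵥ f) ⬝ᵥ x +
        h ⬝ᵥ (A *ᵥ x + B *ᵥ u + f)) +
      (-2 * (h ⬝ᵥ f) + h ⬝ᵥ ((B * R⁻¹ * Bᵀ) *ᵥ h)) =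
    -(x ⬝ᵥ Q *ᵥ x + u ⬝ᵥ R *ᵥ u) +
      (u - optimalFeedback B R P x h) ⬝ᵥ R *ᵥ (u - optimalFeedback B R P x h) := by
  have hRs := (posDef_iff_real.1 hR).1
  have hRu : IsUnit R.det := (Matrix.isUnit_iff_isUnit_det _).1 hR.isUnit
  have hRi : R⁻¹ᵀ = R⁻¹ := by rw [Matrix.transpose_nonsing_inv, hRs]
  set S := B * R⁻¹ * Bᵀ with hS
  have hSs : Sᵀ = S := by
    rw [hS, Matrix.transpose_mul, Matrix.transpose_mul, hRi, Matrix.transpose_transpose,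
      Matrix.mul_assoc]
  set p := P *ᵥ x + h with hp
  set w := R⁻¹ *ᵥ Bᵀ *ᵥ p with hw
  have hRw : R *ᵥ w = Bᵀ *ᵥ p := by
    rw [hw, Matrix.mulVec_mulVec, Matrix.mul_nonsing_inv _ hRu, Matrix.one_mulVec]
  have hwRw : w ⬝ᵥ R *ᵥ w = p ⬝ᵥ S *ᵥ p := by
    rw [hRw, dotProduct_mulVec_transpose, Matrix.transpose_transpose, hw, hS,
      Matrix.mulVec_mulVec, Matrix.mulVec_mulVec, dotProduct_comm, Matrix.mul_assoc]
  have huRw : u ⬝ᵥ R *ᵥ w = (B *ᵥ u) ⬝ᵥ p := by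
    rw [hRw, dotProduct_mulVec_transpose, Matrix.transpose_transpose]
  have hsq : (u - optimalFeedback B R P x h) ⬝ᵥ R *ᵥ (u - optimalFeedback B R P x h) =
      u ⬝ᵥ R *ᵥ u + 2 * ((B *ᵥ u) ⬝ᵥ p) + p ⬝ᵥ S *ᵥ p := by
    have : u - optimalFeedback B R P x h = u + w := by
      rw [optimalFeedback, sub_neg_eq_add]
    rw [this, Matrix.mulVec_add, add_dotProduct, dotProduct_add, dotProduct_add,
      dotProduct_mulVec_symm hRs w u, hwRw, huRw]
    ring
  have hr := congr_arg (fun N => x ⬝ᵥ N *ᵥ x) hric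
  simp only [Matrix.add_mulVec, Matrix.sub_mulVec, dotProduct_add, dotProduct_sub,
    Matrix.zero_mulVec, dotProduct_zero, ← Matrix.mulVec_mulVec] at hr
  have e1 : x ⬝ᵥ P *ᵥ A *ᵥ x = (P *ᵥ x) ⬝ᵥ A *ᵥ x := by rw [dotProduct_mulVec_transpose P, hP]
  have e2 : x ⬝ᵥ Aᵀ *ᵥ P *ᵥ x = (P *ᵥ x) ⬝ᵥ A *ᵥ x := by
    rw [dotProduct_mulVec_transpose Aᵀ, Matrix.transpose_transpose, dotProduct_comm]
  have e3 : x ⬝ᵥ P *ᵥ S *ᵥ P *ᵥ x = (P *ᵥ x) ⬝ᵥ S *ᵥ P *ᵥ x := by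
    rw [dotProduct_mulVec_transpose P, hP]
  rw [e1, e2, e3] at hr
  rw [hsq, dotProduct_mulVec_transpose P x, hP, sub_dotProduct, neg_dotProduct,
    ← dotProduct_mulVec_transpose, Matrix.sub_mulVec, ← Matrix.mulVec_mulVec,
    dotProduct_comm (P *ᵥ f), dotProduct_mulVec_transpose P x, hP, hp]
  simp only [Matrix.mulVec_add, add_dotProduct, dotProduct_add, dotProduct_sub]
  rw [dotProduct_mulVec_symm hSs h (P *ᵥ x), dotProduct_comm (A *ᵥ x), dotProduct_comm (B *ᵥ u),
    dotProduct_comm f, dotProduct_comm (B *ᵥ u)]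
  linarith

theorem isL2_optimalFeedback {x : ℝ → ι → ℝ} (hx : IsL2 x) (hh : IsL2 h) :
    IsL2 fun t => optimalFeedback B R P (x t) (h t) :=
  ((((hx.mulVec P).add hh).mulVec Bᵀ).mulVec R⁻¹).neg

/-- The cost of a square integrable trajectory is the value at the initial state plus the weighted
energy of the deviation of the control from the optimal feedback. -/
theorem IsValueTriple.cost_eq (T : IsValueTriple A (B * R⁻¹ * Bᵀ) Q f P h s) (hR : R.PosDef)
    (hh : IsL2 h) {x : ℝ → ι → ℝ} {u : ℝ → κ → ℝ} (hx : IsL2 x) (hu : IsL2 u)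
    (hsol : IsPrimitive (fun t => A *ᵥ x t + B *ᵥ u t + f t) x) :
    ∫ t in Ioi (0 : ℝ), (x t ⬝ᵥ Q *ᵥ x t + u t ⬝ᵥ R *ᵥ u t) =
      x 0 ⬝ᵥ P *ᵥ x 0 + 2 * (h 0 ⬝ᵥ x 0) + s 0 +
        ∫ t in Ioi (0 : ℝ), (u t - optimalFeedback B R P (x t) (h t)) ⬝ᵥ
          R *ᵥ (u t - optimalFeedback B R P (x t) (h t)) := by
  have hdev := hu.sub (isL2_optimalFeedback (B := B) (R := R) (P := P) hx hh)
  have hi1 : IntegrableOn (fun t => x t ⬝ᵥ Q *ᵥ x t + u t ⬝ᵥ R *ᵥ u t) (Ioi 0) :=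
    (hx.integrable_dotProduct (hx.mulVec Q)).add (hu.integrable_dotProduct (hu.mulVec R))
  have hi2 : IntegrableOn (fun t => (u t - optimalFeedback B R P (x t) (h t)) ⬝ᵥ
      R *ᵥ (u t - optimalFeedback B R P (x t) (h t))) (Ioi 0) :=
    hdev.integrable_dotProduct (hdev.mulVec R)
  have hV := (((hsol.dotProduct (hsol.mulVec P)).add ((T.h_eq.dotProduct hsol).smul 2)).add
    T.s_eq).congr_deriv (b := fun t => -(x t ⬝ᵥ Q *ᵥ x t + u t ⬝ᵥ R *ᵥ u t) +
      (u t - optimalFeedback B R P (x t) (h t)) ⬝ᵥ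
        R *ᵥ (u t - optimalFeedback B R P (x t) (h t))) fun t _ =>
      completion_of_square hR (posSemidef_iff_real.1 T.posSemidef).1 T.riccati _ _ _ _
  have hlim := (hV.tendsto (hi1.neg.add hi2)).sub T.s_lim
  -- without `s` the value function is integrable along the trajectory, so its limit vanishes
  have hzero := eq_zero_of_integrableOn_of_tendsto
    (((hx.integrable_dotProduct (hx.mulVec P)).add
      ((hh.integrable_dotProduct hx).const_mul 2)).congr (ae_of_all _ fun t => by simp)) hlim
  rw [integral_add (f := fun t => -(x t ⬝ᵥ Q *ᵥ x t + u t ⬝ᵥ R *ᵥ u t)) hi1.neg hi2,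
    integral_neg, smul_eq_mul] at hzero
  linarith

theorem IsValueTriple.le_cost (T : IsValueTriple A (B * R⁻¹ * Bᵀ) Q f P h s) (hR : R.PosDef)
    (hh : IsL2 h) {x : ℝ → ι → ℝ} {u : ℝ → κ → ℝ} (hx : IsL2 x) (hu : IsL2 u)
    (hsol : IsPrimitive (fun t => A *ᵥ x t + B *ᵥ u t + f t) x) :
    x 0 ⬝ᵥ P *ᵥ x 0 + 2 * (h 0 ⬝ᵥ x 0) + s 0 ≤
      ∫ t in Ioi (0 : ℝ), (x t ⬝ᵥ Q *ᵥ x t + u t ⬝ᵥ R *ᵥ u t) := by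
  rw [T.cost_eq hR hh hx hu hsol]
  exact le_add_of_nonneg_right
    (integral_nonneg fun t => (posSemidef_iff_real.1 hR.posSemidef).2 _)

variable [DecidableEq ι]

theorem exists_isValueTriple (hR : R.PosDef) (hQ : Q.PosSemidef) (hst : IsStabilizable A B)
    (hdet : IsHautusDetectable A Q) {a γ : ℝ} (hγ : 0 < γ)
    (hm : AEStronglyMeasurable f (volume.restrict (Ioi (0 : ℝ))))
    (hf : ∀ t, 0 ≤ t → ‖f t‖ ≤ a * Real.exp (-γ * t)) :
    ∃ P h s, IsValueTriple A (B * R⁻¹ * Bᵀ) Q f P h s ∧ IsL2 h := by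
  obtain ⟨P, hP, hric⟩ := exists_riccati (B := B) hR hQ hst
  have hH := isHurwitz_of_riccati hR hQ hdet hP hric
  have hfl2 := isL2_of_exp_bound hγ hm hf
  obtain ⟨cP, hcP⟩ : ∃ c : ℝ, 0 ≤ c ∧ ∀ v, ‖P *ᵥ v‖ ≤ c * ‖v‖ :=
    ⟨‖LinearMap.toContinuousLinearMap P.mulVecLin‖, norm_nonneg _,
      (LinearMap.toContinuousLinearMap P.mulVecLin).le_opNorm⟩
  obtain ⟨h, hh, C, hC⟩ := hH.transpose.exists_backward_solution (f := fun t => P *ᵥ f t)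
    (a := cP * a) hγ (hfl2.mulVec P).aestronglyMeasurable fun t ht => by
      have := mul_le_mul_of_nonneg_left (hf t ht) hcP.1
      exact (hcP.2 _).trans (this.trans_eq (by ring))
  have hhl2 := isL2_of_exp_bound hγ (aestronglyMeasurable_of_continuousOn hh.continuousOn) hC
  have hint : IntegrableOn (fun t => -2 * (h t ⬝ᵥ f t) + h t ⬝ᵥ ((B * R⁻¹ * Bᵀ) *ᵥ h t))
      (Ioi 0) :=
    ((hhl2.integrable_dotProduct hfl2).const_mul _).add
      (hhl2.integrable_dotProduct (hhl2.mulVec _))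
  have hs := IsPrimitive.of_integral
    (-∫ t in Ioi (0 : ℝ), (-2 * (h t ⬝ᵥ f t) + h t ⬝ᵥ ((B * R⁻¹ * Bᵀ) *ᵥ h t))) fun t ht =>
      (intervalIntegrable_iff_integrableOn_Ioc_of_le ht).2 (hint.mono_set Ioc_subset_Ioi_self)
  refine ⟨P, h, _, ⟨hP, hric, hh, tendsto_zero_of_exp_bound hγ hC, hs, ?_⟩, hhl2⟩
  simpa using hs.tendsto hint

theorem IsValueTriple.unique (hR : R.PosDef) (hQ : Q.PosSemidef)
    (hdet : IsHautusDetectable A Q) {P' : Matrix ι ι ℝ} {h' : ℝ → ι → ℝ} {s' : ℝ → ℝ}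
    (T : IsValueTriple A (B * R⁻¹ * Bᵀ) Q f P h s)
    (T' : IsValueTriple A (B * R⁻¹ * Bᵀ) Q f P' h' s') :
    P' = P ∧ EqOn h' h (Ici 0) ∧ EqOn s' s (Ici 0) := by
  have hP := riccati_unique hR hQ hdet T.posSemidef T'.posSemidef T.riccati T'.riccati
  subst hP
  have hH := isHurwitz_of_riccati hR hQ hdet T.posSemidef T.riccati
  have hh := backward_solution_unique hH.transpose T.h_eq T'.h_eq T.h_lim T'.h_lim
  refine ⟨rfl, hh, ?_⟩
  have hd := T'.s_eq.sub T.s_eq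
  have hconst : ∀ t, 0 ≤ t → s' t - s t = s' 0 - s 0 := fun t ht =>
    hd.eq_of_deriv_zero (fun t ht => by rw [hh ht, sub_self]) ht
  have h0 : s' 0 - s 0 = 0 := by
    have hlim : Tendsto (fun t => s' t - s t) atTop (𝓝 0) := by simpa using T'.s_lim.sub T.s_lim
    refine tendsto_nhds_unique (tendsto_const_nhds.congr' ?_) hlim
    filter_upwards [eventually_ge_atTop (0 : ℝ)] with t ht using (hconst t ht).symm
  intro t ht
  exact sub_eq_zero.1 ((hconst t ht).trans h0)

/-- Open-loop realization of the optimal feedback. -/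
theorem IsValueTriple.exists_optimal (T : IsValueTriple A (B * R⁻¹ * Bᵀ) Q f P h s)
    (hR : R.PosDef) (hQ : Q.PosSemidef) (hdet : IsHautusDetectable A Q) (hh : IsL2 h)
    (hf : IsL2 f) (x₀ : ι → ℝ) :
    ∃ (x : ℝ → ι → ℝ) (u : ℝ → κ → ℝ), x 0 = x₀ ∧ IsL2 x ∧ IsL2 u ∧
      IsPrimitive (fun t => A *ᵥ x t + B *ᵥ u t + f t) x ∧
      ∫ t in Ioi (0 : ℝ), (x t ⬝ᵥ Q *ᵥ x t + u t ⬝ᵥ R *ᵥ u t) =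
        x 0 ⬝ᵥ P *ᵥ x 0 + 2 * (h 0 ⬝ᵥ x 0) + s 0 := by
  have hH := isHurwitz_of_riccati hR hQ hdet T.posSemidef T.riccati
  have hg : IsL2 fun t => f t - (B * R⁻¹ * Bᵀ) *ᵥ h t := hf.sub (hh.mulVec _)
  obtain ⟨x, hx0, hx⟩ := exists_linear_solution (A - B * R⁻¹ * Bᵀ * P) x₀
    fun t ht => hg.intervalIntegrable ht
  obtain ⟨C, -, hC⟩ := hH.exists_l2_bound
  have hxl2 := (hC x _ hx hg).1
  have hul2 := isL2_optimalFeedback (B := B) (R := R) (P := P) hxl2 hh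
  have hsol : IsPrimitive (fun t => A *ᵥ x t + B *ᵥ optimalFeedback B R P (x t) (h t) + f t) x :=
    hx.congr_deriv fun t _ => by
      simp only [optimalFeedback, Matrix.sub_mulVec, Matrix.mulVec_neg, Matrix.mulVec_add,
        Matrix.mulVec_mulVec, Matrix.mul_assoc]
      abel
  refine ⟨x, _, hx0, hxl2, hul2, hsol, ?_⟩
  rw [T.cost_eq hR hh hxl2 hul2 hsol]
  simp

end LinearQuadratic

/-! ### Block structure of the partial cheap control problem -/

section Blocks

variable {α β κ : Type*} [Fintype α] [Fintype β] [Fintype κ]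

theorem eq_zero_of_comp_inl_inr {α β : Type*} {v : α ⊕ β → ℝ} (h1 : v ∘ Sum.inl = 0) (h2 : v ∘ Sum.inr = 0) :
    v = 0 := by
  ext (i | i)
  · exact congr_fun h1 i
  · exact congr_fun h2 i

theorem IsEigenpair.fromBlocks {A₁ : Matrix α α ℝ} {A₂ : Matrix α β ℝ} {A₃ : Matrix β α ℝ}
    {A₄ : Matrix β β ℝ} {σ ω : ℝ} {a b : α ⊕ β → ℝ}
    (h : IsEigenpair (Matrix.fromBlocks A₁ A₂ A₃ A₄) σ ω a b) :
    (A₁ *ᵥ (a ∘ Sum.inl) + A₂ *ᵥ (a ∘ Sum.inr) =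
        σ • (a ∘ Sum.inl) - ω • (b ∘ Sum.inl) ∧
      A₁ *ᵥ (b ∘ Sum.inl) + A₂ *ᵥ (b ∘ Sum.inr) =
        ω • (a ∘ Sum.inl) + σ • (b ∘ Sum.inl)) ∧
    (A₃ *ᵥ (a ∘ Sum.inl) + A₄ *ᵥ (a ∘ Sum.inr) =
        σ • (a ∘ Sum.inr) - ω • (b ∘ Sum.inr) ∧
      A₃ *ᵥ (b ∘ Sum.inl) + A₄ *ᵥ (b ∘ Sum.inr) =
        ω • (a ∘ Sum.inr) + σ • (b ∘ Sum.inr)) := by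
  obtain ⟨h1, h2⟩ := h
  rw [Matrix.fromBlocks_mulVec] at h1 h2
  exact ⟨⟨congr_arg (· ∘ Sum.inl) h1, congr_arg (· ∘ Sum.inl) h2⟩,
    ⟨congr_arg (· ∘ Sum.inr) h1, congr_arg (· ∘ Sum.inr) h2⟩⟩

theorem IsHautusDetectable.fromBlocks {A₁ D₁ : Matrix α α ℝ} (h : IsHautusDetectable A₁ D₁)
    {D₂ : Matrix β β ℝ} (hD₂ : D₂.PosDef) (A₂ : Matrix α β ℝ) (A₃ : Matrix β α ℝ)
    (A₄ : Matrix β β ℝ) :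
    IsHautusDetectable (Matrix.fromBlocks A₁ A₂ A₃ A₄) (Matrix.fromBlocks D₁ 0 0 D₂) := by
  intro σ ω a b hσ hab ha hb
  have key : ∀ v : α ⊕ β → ℝ, Matrix.fromBlocks D₁ 0 0 D₂ *ᵥ v = 0 →
      D₁ *ᵥ (v ∘ Sum.inl) = 0 ∧ v ∘ Sum.inr = 0 := by
    intro v hv
    rw [Matrix.fromBlocks_mulVec] at hv
    have e1 := congr_arg (· ∘ Sum.inl) hv
    have e2 := congr_arg (· ∘ Sum.inr) hv
    simp only [Matrix.zero_mulVec, add_zero, zero_add] at e1 e2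
    refine ⟨e1, ?_⟩
    by_contra hne
    have e2' : D₂ *ᵥ (v ∘ Sum.inr) = 0 := e2
    have := (posDef_iff_real.1 hD₂).2 hne
    rw [e2', dotProduct_zero] at this
    exact this.false
  obtain ⟨ha1, ha2⟩ := key a ha
  obtain ⟨hb1, hb2⟩ := key b hb
  obtain ⟨⟨u1, u2⟩, -⟩ := hab.fromBlocks
  rw [ha2, Matrix.mulVec_zero, add_zero] at u1
  rw [hb2, Matrix.mulVec_zero, add_zero] at u2
  obtain ⟨z1, z2⟩ := h σ ω _ _ hσ ⟨u1, u2⟩ ha1 hb1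
  exact ⟨eq_zero_of_comp_inl_inr z1 ha2, eq_zero_of_comp_inl_inr z2 hb2⟩

theorem dotProduct_fromBlocks_diag (M₁ : Matrix α α ℝ) (M₂ : Matrix β β ℝ) (v : α ⊕ β → ℝ) :
    v ⬝ᵥ Matrix.fromBlocks M₁ 0 0 M₂ *ᵥ v =
      (v ∘ Sum.inl) ⬝ᵥ M₁ *ᵥ (v ∘ Sum.inl) + (v ∘ Sum.inr) ⬝ᵥ M₂ *ᵥ (v ∘ Sum.inr) := by
  rw [Matrix.fromBlocks_mulVec]
  simp [dotProduct, Fintype.sum_sum_type]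

theorem posDef_fromBlocks_diag {M₁ : Matrix α α ℝ} {M₂ : Matrix β β ℝ} (h1 : M₁.PosDef)
    (h2 : M₂.PosDef) : (Matrix.fromBlocks M₁ 0 0 M₂).PosDef := by
  obtain ⟨s1, p1⟩ := posDef_iff_real.1 h1
  obtain ⟨s2, p2⟩ := posDef_iff_real.1 h2
  refine posDef_iff_real.2 ⟨by simp [Matrix.fromBlocks_transpose, s1, s2], fun v hv => ?_⟩
  rw [dotProduct_fromBlocks_diag]
  have n1 := (posSemidef_iff_real.1 h1.posSemidef).2 (v ∘ Sum.inl)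
  have n2 := (posSemidef_iff_real.1 h2.posSemidef).2 (v ∘ Sum.inr)
  by_cases hl : v ∘ Sum.inl = 0
  · have hr : v ∘ Sum.inr ≠ 0 := fun hr => hv (eq_zero_of_comp_inl_inr hl hr)
    have := p2 hr
    linarith
  · have := p1 hl
    linarith

variable [DecidableEq α] [DecidableEq β]

theorem isHurwitz_neg_one : IsHurwitz (-1 : Matrix α α ℝ) := by
  refine isHurwitz_iff.2 fun σ ω a b hσ hab => ?_
  have h1 : ∀ i, -a i = σ * a i - ω * b i := fun i => by
    simpa [Matrix.neg_mulVec] using congr_fun hab.1 i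
  have h2 : ∀ i, -b i = ω * a i + σ * b i := fun i => by
    simpa [Matrix.neg_mulVec] using congr_fun hab.2 i
  have hpos : 0 < (1 + σ) ^ 2 + ω ^ 2 := by positivity
  constructor
  · ext i
    refine (mul_eq_zero.1 (?_ : ((1 + σ) ^ 2 + ω ^ 2) * a i = 0)).resolve_left hpos.ne'
    linear_combination (-(1 + σ)) * h1 i - ω * h2 i
  · ext i
    refine (mul_eq_zero.1 (?_ : ((1 + σ) ^ 2 + ω ^ 2) * b i = 0)).resolve_left hpos.ne'
    linear_combination ω * h1 i - (1 + σ) * h2 i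

theorem IsHurwitz.of_semiconj {N N' S : Matrix α α ℝ} (hN' : IsHurwitz N')
    (hS : IsUnit S) (h : S * N = N' * S) : IsHurwitz N := by
  have hinj := Matrix.mulVec_injective_iff_isUnit.2 hS
  refine isHurwitz_iff.2 fun σ ω a b hσ hab => ?_
  have key : IsEigenpair N' σ ω (S *ᵥ a) (S *ᵥ b) := by
    constructor
    · rw [Matrix.mulVec_mulVec, ← h, ← Matrix.mulVec_mulVec, hab.1]
      simp [Matrix.mulVec_sub, Matrix.mulVec_smul]
    · rw [Matrix.mulVec_mulVec, ← h, ← Matrix.mulVec_mulVec, hab.2]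
      simp [Matrix.mulVec_add, Matrix.mulVec_smul]
  obtain ⟨ha, hb⟩ := isHurwitz_iff.1 hN' σ ω _ _ hσ key
  exact ⟨hinj (by simpa using ha), hinj (by simpa using hb)⟩

theorem IsHurwitz.fromBlocks_zero₂₁ {M₁ : Matrix α α ℝ} {M₂ : Matrix β β ℝ}
    (h1 : IsHurwitz M₁) (h2 : IsHurwitz M₂) (C : Matrix α β ℝ) :
    IsHurwitz (Matrix.fromBlocks M₁ C 0 M₂) := by
  refine isHurwitz_iff.2 fun σ ω a b hσ hab => ?_
  obtain ⟨⟨u1, u2⟩, l1, l2⟩ := hab.fromBlocks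
  rw [Matrix.zero_mulVec, zero_add] at l1 l2
  obtain ⟨ha2, hb2⟩ := isHurwitz_iff.1 h2 σ ω _ _ hσ ⟨l1, l2⟩
  rw [ha2, Matrix.mulVec_zero, add_zero] at u1
  rw [hb2, Matrix.mulVec_zero, add_zero] at u2
  obtain ⟨ha1, hb1⟩ := isHurwitz_iff.1 h1 σ ω _ _ hσ ⟨u1, u2⟩
  exact ⟨eq_zero_of_comp_inl_inr ha1 ha2, eq_zero_of_comp_inl_inr hb1 hb2⟩

/-- Backstepping: if the slow subsystem is stabilizable with the fast state as an additional
control, then so is the full system, whose fast state is directly controlled. -/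
theorem IsStabilizable.fromBlocks {A₁ : Matrix α α ℝ} {A₂ : Matrix α β ℝ} {E : Matrix α κ ℝ}
    (h : IsStabilizable A₁ (Matrix.fromCols E A₂)) (A₃ : Matrix β α ℝ) (A₄ : Matrix β β ℝ)
    (H : Matrix β κ ℝ) :
    IsStabilizable (Matrix.fromBlocks A₁ A₂ A₃ A₄)
      (Matrix.fromBlocks E (0 : Matrix α β ℝ) H (1 : Matrix β β ℝ)) := by
  obtain ⟨K, hK⟩ := h
  obtain ⟨K₁, K₂, rfl⟩ : ∃ K₁ K₂, K = Matrix.fromRows K₁ K₂ :=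
    ⟨_, _, (Matrix.fromRows_toRows K).symm⟩
  rw [Matrix.fromCols_mul_fromRows] at hK
  set M := A₁ + (E * K₁ + A₂ * K₂) with hM
  -- in the coordinates `x`, `y - K₂ x` the closed loop is triangular with blocks `M` and `-1`
  let S : Matrix (α ⊕ β) (α ⊕ β) ℝ := Matrix.fromBlocks 1 0 (-K₂) 1
  let N₃ : Matrix β α ℝ := K₂ * M - (K₂ * A₂ - 1) * K₂
  let N₄ : Matrix β β ℝ := K₂ * A₂ - 1
  have hS : IsUnit S := by
    rw [Matrix.isUnit_iff_isUnit_det]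
    simp [S]
  refine ⟨Matrix.fromBlocks K₁ 0 (N₃ - A₃ - H * K₁) (N₄ - A₄),
    (hK.fromBlocks_zero₂₁ isHurwitz_neg_one A₂).of_semiconj hS ?_⟩
  simp only [S, N₃, N₄, Matrix.fromBlocks_multiply, Matrix.fromBlocks_add, Matrix.fromBlocks_inj]
  refine ⟨?_, ?_, ?_, ?_⟩
  · simp [hM]
    abel
  · simp
  · simp only [hM, Matrix.mul_add, Matrix.sub_mul, Matrix.neg_mul, Matrix.one_mul,
      Matrix.mul_assoc, Matrix.zero_mul, add_zero, zero_add]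
    simp
    abel
  · simp
    abel

end Blocks

namespace Data

variable {p q m : ℕ} (d : Data p q m)

/-- The input matrix `B̃` of the regular controls in the slow subsystem. -/
def Btil (p q : ℕ) : Matrix (SlowIx p q) (Fin q) ℝ :=
  fromRows (0 : Matrix (Fin p) (Fin q) ℝ) (1 : Matrix (Fin q) (Fin q) ℝ)

/-- The weight `diag(G̃, D₂)` of the controls `(u₁, y)` of the reduced problem. -/
def R₀ : Matrix (CtrlIx q m) (CtrlIx q m) ℝ := fromBlocks (Matrix.diagonal d.g) 0 0 d.D₂

/-- The input matrix of the regular controls in the fast subsystem. -/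
def H₂ : Matrix (Fin m) (Fin q) ℝ := d.ℋ * Btil p q

theorem isUnit_T (hc : IsUnit (fromCols d.ℬtc d.ℬ₂).det) : IsUnit d.T.det := by
  have : d.T = fromCols d.ℬtc d.ℬ₂ * fromBlocks 1 0 (-d.ℋ) 1 := by
    rw [Matrix.fromCols_mul_fromBlocks]
    simp [T, ℒ, sub_eq_add_neg]
  rw [this, Matrix.det_mul]
  simpa using hc

theorem B_eq (hc : IsUnit (fromCols d.ℬtc d.ℬ₂).det) :
    d.B = fromBlocks (Btil p q) 0 d.H₂ 1 := by
  have : d.ℬ = d.T * fromBlocks (Btil p q) 0 d.H₂ 1 := by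
    have h1 : d.ℬtc * Btil p q = d.ℬ₁ := by
      rw [ℬtc, Btil, Matrix.fromCols_mul_fromRows]
      simp
    rw [T, Matrix.fromCols_mul_fromBlocks, ℒ, H₂, Matrix.sub_mul, h1, Matrix.mul_assoc]
    simp [ℬ₁, ℬ₂]
  rw [B]
  nth_rewrite 1 [this]
  rw [Matrix.nonsing_inv_mul_cancel_left _ _ (d.isUnit_T hc)]

theorem D₂_posDef (hA2 : d.𝒟.PosSemidef) (hA5 : d.D₂.det ≠ 0) : d.D₂.PosDef := by
  have h : d.D₂.PosSemidef := posSemidef_transpose_mul_mul hA2 _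
  exact h.posDef_iff_isUnit.2 ((Matrix.isUnit_iff_isUnit_det _).2 (isUnit_iff_ne_zero.2 hA5))

theorem D₁_posSemidef (hA2 : d.𝒟.PosSemidef) : d.D₁.PosSemidef :=
  posSemidef_transpose_mul_mul hA2 _

/-- The transformation is chosen so that the state weight becomes block diagonal. -/
theorem D_eq (hA2 : d.𝒟.PosSemidef) (hA5 : d.D₂.det ≠ 0) :
    d.D = fromBlocks d.D₁ 0 0 d.D₂ := by
  have hs := (posSemidef_iff_real.1 hA2).1
  have hu : IsUnit d.D₂.det := isUnit_iff_ne_zero.2 hA5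
  have h21 : d.ℬ₂ᵀ * d.𝒟 * d.ℒ = 0 := by
    rw [ℒ, Matrix.mul_sub, ← Matrix.mul_assoc _ d.ℬ₂, ℋ, ← D₂, Matrix.mul_assoc d.D₂⁻¹,
      Matrix.mul_assoc d.D₂⁻¹, Matrix.mul_nonsing_inv_cancel_left _ _ hu, sub_self]
  have h12 : d.ℒᵀ * d.𝒟 * d.ℬ₂ = 0 := by
    have := congr_arg Matrix.transpose h21
    simpa [hs, Matrix.mul_assoc] using this
  rw [D, T, Matrix.transpose_fromCols, Matrix.fromRows_mul, Matrix.fromRows_mul_fromCols, h12, h21]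
  rfl

theorem R₀_posDef (hA3 : ∀ i, 0 < d.g i) (hD₂ : d.D₂.PosDef) : d.R₀.PosDef :=
  posDef_fromBlocks_diag (Matrix.PosDef.diagonal hA3) hD₂

theorem Gε_eq (ε : ℝ) : d.Gε ε =
    fromBlocks (Matrix.diagonal d.g) 0 0 (Matrix.diagonal fun _ => ε ^ 2) := by
  rw [Gε, Matrix.fromBlocks_diagonal]

theorem Gε_posDef (hA3 : ∀ i, 0 < d.g i) {ε : ℝ} (hε : 0 < ε) : (d.Gε ε).PosDef := by
  rw [Gε_eq]
  exact posDef_fromBlocks_diag (Matrix.PosDef.diagonal hA3)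
    (Matrix.PosDef.diagonal fun _ => by positivity)

theorem S₀_eq (hA3 : ∀ i, 0 < d.g i) (hA5 : d.D₂.det ≠ 0) :
    d.S₀ = d.Bbar * d.R₀⁻¹ * d.Bbarᵀ := by
  have hg : IsUnit (Matrix.diagonal d.g).det := by
    rw [Matrix.det_diagonal, isUnit_iff_ne_zero]
    exact Finset.prod_ne_zero_iff.2 fun i _ => (hA3 i).ne'
  have hR : d.R₀⁻¹ = fromBlocks (Matrix.diagonal d.g)⁻¹ 0 0 d.D₂⁻¹ := by
    refine Matrix.inv_eq_right_inv ?_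
    rw [R₀, Matrix.fromBlocks_multiply, Matrix.mul_nonsing_inv _ hg,
      Matrix.mul_nonsing_inv _ (isUnit_iff_ne_zero.2 hA5)]
    simp
  rw [hR, Bbar, Matrix.transpose_fromCols, Matrix.fromCols_mul_fromBlocks,
    Matrix.fromCols_mul_fromRows, S₀, S₁, Matrix.transpose_fromRows, Matrix.fromRows_mul]
  simp only [Matrix.mul_zero, add_zero, zero_add, Matrix.zero_mul, Matrix.one_mul]
  rw [add_comm, Matrix.fromRows_mul_fromCols]
  simp

theorem A_eq : d.A = fromBlocks d.A₁ d.A₂ d.A.toBlocks₂₁ d.A.toBlocks₂₂ :=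
  (Matrix.fromBlocks_toBlocks _).symm

theorem isReducedSolution_iff (hA3 : ∀ i, 0 < d.g i) (hA5 : d.D₂.det ≠ 0)
    {P : Matrix (SlowIx p q) (SlowIx p q) ℝ} {h : ℝ → SlowIx p q → ℝ} {s : ℝ → ℝ} :
    d.IsReducedSolution P h s ↔
      IsValueTriple d.A₁ (d.Bbar * d.R₀⁻¹ * d.Bbarᵀ) d.D₁ d.f₁ P h s := by
  rw [← d.S₀_eq hA3 hA5]
  exact ⟨fun H => ⟨H.1, H.2, H.3, H.4, H.5, H.6⟩, fun H => ⟨H.1, H.2, H.3, H.4, H.5, H.6⟩⟩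

end Data

/-! ### A suboptimal control with a boundary layer -/

section BoundedFamilies

variable {ι κ : Type*} [Fintype ι] [Fintype κ]

theorem IsL2.comp_index {x : ℝ → ι → ℝ} (hx : IsL2 x) (e : κ → ι) : IsL2 fun t => x t ∘ e :=
  MemLp.of_eval fun i => hx.eval (e i)

theorem IsPrimitive.comp_index {a x : ℝ → ι → ℝ} (hx : IsPrimitive a x) (e : κ → ι) :
    IsPrimitive (fun t => a t ∘ e) (fun t => x t ∘ e) :=
  IsPrimitive.pi fun i => hx.apply (e i)

theorem IsL2.sumElim {x : ℝ → ι → ℝ} {y : ℝ → κ → ℝ} (hx : IsL2 x) (hy : IsL2 y) :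
    IsL2 fun t => Sum.elim (x t) (y t) :=
  MemLp.of_eval fun i => match i with
    | Sum.inl i => hx.eval i
    | Sum.inr i => hy.eval i

theorem IsPrimitive.sumElim {a x : ℝ → ι → ℝ} {b y : ℝ → κ → ℝ} (hx : IsPrimitive a x)
    (hy : IsPrimitive b y) :
    IsPrimitive (fun t => Sum.elim (a t) (b t)) (fun t => Sum.elim (x t) (y t)) :=
  IsPrimitive.pi fun i => match i with
    | Sum.inl i => hx.apply i
    | Sum.inr i => hy.apply i

/-- A family of functions of time, indexed by `ε ∈ (0, 1]`, is bounded in `L²(0, +∞)`. -/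
def IsBoundedL2 (x : ℝ → ℝ → ι → ℝ) : Prop :=
  ∃ K : ℝ, ∀ ε, 0 < ε → ε ≤ 1 → IsL2 (x ε) ∧ ∫ t in Ioi (0 : ℝ), x ε t ⬝ᵥ x ε t ≤ K

theorem integral_dotProduct_add_le {x y : ℝ → ι → ℝ} (hx : IsL2 x) (hy : IsL2 y) :
    ∫ t in Ioi (0 : ℝ), (x t + y t) ⬝ᵥ (x t + y t) ≤
      2 * (∫ t in Ioi (0 : ℝ), x t ⬝ᵥ x t) + 2 * ∫ t in Ioi (0 : ℝ), y t ⬝ᵥ y t := by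
  have hxi := hx.integrable_dotProduct hx
  have hyi := hy.integrable_dotProduct hy
  rw [← integral_const_mul, ← integral_const_mul,
    ← integral_add (hxi.const_mul _) (hyi.const_mul _)]
  refine integral_mono ((hx.add hy).integrable_dotProduct (hx.add hy))
    ((hxi.const_mul _).add (hyi.const_mul _)) fun t => ?_
  have := dotProduct_self_nonneg (x t - y t)
  simp only [sub_dotProduct, dotProduct_sub] at this
  simp only [add_dotProduct, dotProduct_add]
  linarith

theorem integral_dotProduct_mulVec_le {M : Matrix ι ι ℝ} {c : ℝ}
    (hc : ∀ v : ι → ℝ, v ⬝ᵥ M *ᵥ v ≤ c * (v ⬝ᵥ v)) {x : ℝ → ι → ℝ} (hx : IsL2 x) :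
    ∫ t in Ioi (0 : ℝ), x t ⬝ᵥ M *ᵥ x t ≤ c * ∫ t in Ioi (0 : ℝ), x t ⬝ᵥ x t := by
  rw [← integral_const_mul]
  exact integral_mono (hx.integrable_dotProduct (hx.mulVec M))
    ((hx.integrable_dotProduct hx).const_mul _) fun t => hc _

namespace IsBoundedL2

theorem const {x : ℝ → ι → ℝ} (hx : IsL2 x) : IsBoundedL2 fun _ => x :=
  ⟨_, fun _ _ _ => ⟨hx, le_rfl⟩⟩

theorem add {x y : ℝ → ℝ → ι → ℝ} (hx : IsBoundedL2 x) (hy : IsBoundedL2 y) :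
    IsBoundedL2 fun ε t => x ε t + y ε t := by
  obtain ⟨K, hK⟩ := hx
  obtain ⟨L, hL⟩ := hy
  refine ⟨2 * K + 2 * L, fun ε h0 h1 => ?_⟩
  obtain ⟨hx, hxK⟩ := hK ε h0 h1
  obtain ⟨hy, hyL⟩ := hL ε h0 h1
  refine ⟨hx.add hy, (integral_dotProduct_add_le hx hy).trans ?_⟩
  linarith

theorem mulVec {x : ℝ → ℝ → ι → ℝ} (hx : IsBoundedL2 x) (M : Matrix κ ι ℝ) :
    IsBoundedL2 fun ε t => M *ᵥ x ε t := by
  obtain ⟨K, hK⟩ := hx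
  obtain ⟨c, hc, h⟩ := exists_mulVec_sq_bound M
  refine ⟨c * K, fun ε h0 h1 => ?_⟩
  obtain ⟨hx, hxK⟩ := hK ε h0 h1
  refine ⟨hx.mulVec M, le_trans ?_ (mul_le_mul_of_nonneg_left hxK hc)⟩
  rw [← integral_const_mul]
  exact integral_mono ((hx.mulVec M).integrable_dotProduct (hx.mulVec M))
    ((hx.integrable_dotProduct hx).const_mul _) fun t => h _

theorem neg {x : ℝ → ℝ → ι → ℝ} (hx : IsBoundedL2 x) : IsBoundedL2 fun ε t => -x ε t := by
  obtain ⟨K, hK⟩ := hx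
  refine ⟨K, fun ε h0 h1 => ⟨(hK ε h0 h1).1.neg, ?_⟩⟩
  simpa using (hK ε h0 h1).2

theorem sub {x y : ℝ → ℝ → ι → ℝ} (hx : IsBoundedL2 x) (hy : IsBoundedL2 y) :
    IsBoundedL2 fun ε t => x ε t - y ε t := by
  simpa only [sub_eq_add_neg] using hx.add hy.neg

theorem comp_index [DecidableEq ι] {x : ℝ → ℝ → ι → ℝ} (hx : IsBoundedL2 x) (e : κ → ι) :
    IsBoundedL2 fun ε t => x ε t ∘ e := by
  have := hx.mulVec (Matrix.of fun i j => if e i = j then (1 : ℝ) else 0)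
  convert! this using 3 with ε t
  ext i
  simp [Matrix.mulVec, dotProduct]

theorem optimalFeedback [DecidableEq κ] {x h : ℝ → ℝ → ι → ℝ} (B : Matrix ι κ ℝ)
    (R : Matrix κ κ ℝ) (P : Matrix ι ι ℝ) (hx : IsBoundedL2 x) (hh : IsBoundedL2 h) :
    IsBoundedL2 fun ε t => optimalFeedback B R P (x ε t) (h ε t) :=
  ((((hx.mulVec P).add hh).mulVec Bᵀ).mulVec R⁻¹).neg

end IsBoundedL2

theorem IsPrimitive.optimalFeedback [DecidableEq κ] {a b x h : ℝ → ι → ℝ} (B : Matrix ι κ ℝ)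
    (R : Matrix κ κ ℝ) (P : Matrix ι ι ℝ) (hx : IsPrimitive a x) (hh : IsPrimitive b h) :
    IsPrimitive (fun t => optimalFeedback B R P (a t) (b t))
      (fun t => optimalFeedback B R P (x t) (h t)) := by
  simpa [CheapControl.optimalFeedback] using
    ((((hx.mulVec P).add hh).mulVec Bᵀ).mulVec R⁻¹).smul (-1)

end BoundedFamilies

section BoundaryLayer

variable {ι : Type*} [Fintype ι]

/-- The boundary layer profile `e^{-t/ε} w₀`. -/
def layer (w₀ : ι → ℝ) (ε t : ℝ) : ι → ℝ := Real.exp (-ε⁻¹ * t) • w₀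

theorem isL2_layer (w₀ : ι → ℝ) {ε : ℝ} (hε : 0 < ε) : IsL2 (layer w₀ ε) :=
  MemLp.of_eval fun i => by
    simpa [layer, mul_comm] using (isL2_exp (inv_pos.2 hε)).const_mul (w₀ i)

theorem integral_layer (w₀ : ι → ℝ) {ε : ℝ} (hε : 0 < ε) :
    ∫ t in Ioi (0 : ℝ), layer w₀ ε t ⬝ᵥ layer w₀ ε t = ε / 2 * (w₀ ⬝ᵥ w₀) := by
  have h : ∀ t, layer w₀ ε t ⬝ᵥ layer w₀ ε t = Real.exp (-(2 * ε⁻¹) * t) * (w₀ ⬝ᵥ w₀) := by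
    intro t
    simp only [layer, smul_dotProduct, dotProduct_smul, smul_eq_mul]
    rw [← mul_assoc, ← Real.exp_add]
    congr 2
    ring
  simp only [h]
  have hpos : 0 < ε⁻¹ := inv_pos.2 hε
  rw [integral_mul_const, integral_exp_mul_Ioi (by linarith)]
  simp
  left
  ring

theorem isBoundedL2_layer (w₀ : ι → ℝ) : IsBoundedL2 (layer w₀) := by
  refine ⟨w₀ ⬝ᵥ w₀, fun ε h0 h1 => ⟨isL2_layer w₀ h0, ?_⟩⟩
  rw [integral_layer w₀ h0]
  have := dotProduct_self_nonneg w₀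
  nlinarith

theorem isPrimitive_layer (w₀ : ι → ℝ) (ε : ℝ) :
    IsPrimitive (fun t => -(ε⁻¹ • layer w₀ ε t)) (layer w₀ ε) := by
  refine IsPrimitive.of_hasDerivAt (fun t => ?_) ?_
  · have h1 : HasDerivAt (fun t : ℝ => Real.exp (-ε⁻¹ * t)) (Real.exp (-ε⁻¹ * t) * (-ε⁻¹)) t := by
      simpa using ((hasDerivAt_id t).const_mul (-ε⁻¹)).exp
    have h2 := h1.smul_const w₀
    convert! h2 using 1
    rw [layer, ← neg_smul, smul_smul, mul_comm]
  · unfold layer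
    fun_prop

end BoundaryLayer

section CompositeControl

variable {α β κ : Type*} [Fintype α] [Fintype β] [Fintype κ] [DecidableEq α] [DecidableEq β]
  [DecidableEq κ]

/-- A control of the full system whose cost exceeds the value of the reduced problem by `O(ε)`. The
pair `(u₁, y)` is the optimal feedback of the reduced problem plus a boundary layer, and the cheap
control `u₂` is read off from the equation for the fast state `y`. -/
theorem IsValueTriple.exists_composite_control {A₁ Q P : Matrix α α ℝ} {A₂ : Matrix α β ℝ}
    {E : Matrix α κ ℝ} {R : Matrix (κ ⊕ β) (κ ⊕ β) ℝ} {f₁ h : ℝ → α → ℝ} {s : ℝ → ℝ}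
    (T : IsValueTriple A₁ (fromCols E A₂ * R⁻¹ * (fromCols E A₂)ᵀ) Q f₁ P h s)
    (hR : R.PosDef) (hQ : Q.PosSemidef) (hdet : IsHautusDetectable A₁ Q) (hh : IsL2 h)
    (hf₁ : IsL2 f₁) {f₂ : ℝ → β → ℝ} (hf₂ : IsL2 f₂)
    (A₃ : Matrix β α ℝ) (A₄ : Matrix β β ℝ) (H : Matrix β κ ℝ) (x₀ : α → ℝ) (y₀ : β → ℝ) :
    ∃ c : ℝ, 0 < c ∧ ∀ ε, 0 < ε → ε ≤ 1 →
      ∃ (x : ℝ → α → ℝ) (y : ℝ → β → ℝ) (u₁ : ℝ → κ → ℝ) (u₂ : ℝ → β → ℝ),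
        x 0 = x₀ ∧ y 0 = y₀ ∧ IsL2 x ∧ IsL2 y ∧ IsL2 u₁ ∧ IsL2 u₂ ∧
        IsPrimitive (fun t => A₁ *ᵥ x t + A₂ *ᵥ y t + E *ᵥ u₁ t + f₁ t) x ∧
        IsPrimitive (fun t => A₃ *ᵥ x t + A₄ *ᵥ y t + H *ᵥ u₁ t + u₂ t + f₂ t) y ∧
        (∫ t in Ioi (0 : ℝ), (x t ⬝ᵥ Q *ᵥ x t +
            Sum.elim (u₁ t) (y t) ⬝ᵥ R *ᵥ Sum.elim (u₁ t) (y t))) +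
          ε ^ 2 * ∫ t in Ioi (0 : ℝ), u₂ t ⬝ᵥ u₂ t ≤
        x₀ ⬝ᵥ P *ᵥ x₀ + 2 * (h 0 ⬝ᵥ x₀) + s 0 + c * ε := by
  set B := fromCols E A₂ with hB
  have hH := isHurwitz_of_riccati hR hQ hdet T.posSemidef T.riccati
  let w₀ : κ ⊕ β → ℝ := Sum.elim 0 (y₀ - optimalFeedback B R P x₀ (h 0) ∘ Sum.inr)
  let g : ℝ → ℝ → α → ℝ := fun ε t => f₁ t - (B * R⁻¹ * Bᵀ) *ᵥ h t + B *ᵥ layer w₀ ε t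
  have hg : IsBoundedL2 g :=
    ((IsBoundedL2.const hf₁).sub ((IsBoundedL2.const hh).mulVec _)).add
      ((isBoundedL2_layer w₀).mulVec B)
  have hgi : ∀ ε t, 0 ≤ t → IntervalIntegrable (g ε) volume 0 t := by
    intro ε t ht
    refine ((hf₁.sub (hh.mulVec _)).intervalIntegrable ht).add ?_
    refine Continuous.intervalIntegrable ?_ _ _
    unfold layer
    fun_prop
  choose x hx0 hx using fun ε => exists_linear_solution (A₁ - B * R⁻¹ * Bᵀ * P) x₀ (hgi ε)
  have hxb : IsBoundedL2 x := by
    obtain ⟨C, hC, hb⟩ := hH.exists_l2_bound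
    obtain ⟨K, hK⟩ := hg
    refine ⟨C * (x₀ ⬝ᵥ x₀ + K), fun ε h0 h1 => ?_⟩
    obtain ⟨hgl, hgK⟩ := hK ε h0 h1
    obtain ⟨hxl, hxK⟩ := hb _ _ (hx ε) hgl
    refine ⟨hxl, hxK.trans ?_⟩
    rw [hx0]
    exact mul_le_mul_of_nonneg_left (by linarith) hC
  -- the combined control `(u₁, y)` of the reduced problem: optimal feedback plus boundary layer
  let v : ℝ → ℝ → κ ⊕ β → ℝ := fun ε t => optimalFeedback B R P (x ε t) (h t) + layer w₀ ε t
  have hvb : IsBoundedL2 v :=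
    (hxb.optimalFeedback B R P (IsBoundedL2.const hh)).add (isBoundedL2_layer w₀)
  let x' : ℝ → ℝ → α → ℝ := fun ε t => A₁ *ᵥ x ε t + B *ᵥ v ε t + f₁ t
  have hx'b : IsBoundedL2 x' := ((hxb.mulVec _).add (hvb.mulVec _)).add (IsBoundedL2.const hf₁)
  have hx' : ∀ ε, IsPrimitive (x' ε) (x ε) := fun ε =>
    (hx ε).congr_deriv fun t _ => by
      simp only [x', v, g, optimalFeedback, Matrix.sub_mulVec, Matrix.mulVec_neg,
        Matrix.mulVec_add, Matrix.mulVec_mulVec, Matrix.mul_assoc]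
      abel
  let h' : ℝ → α → ℝ := fun t => -((A₁ - B * R⁻¹ * Bᵀ * P)ᵀ *ᵥ h t) - P *ᵥ f₁ t
  have hh' : IsL2 h' := (hh.mulVec _).neg.sub (hf₁.mulVec _)
  let G : ℝ → ℝ → β → ℝ := fun ε t => optimalFeedback B R P (x' ε t) (h' t) ∘ Sum.inr -
    (A₃ *ᵥ x ε t + A₄ *ᵥ (v ε t ∘ Sum.inr) + H *ᵥ (v ε t ∘ Sum.inl) + f₂ t)
  have hGb : IsBoundedL2 G :=
    ((hx'b.optimalFeedback B R P (IsBoundedL2.const hh')).comp_index Sum.inr).sub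
      ((((hxb.mulVec A₃).add ((hvb.comp_index Sum.inr).mulVec A₄)).add
        ((hvb.comp_index Sum.inl).mulVec H)).add (IsBoundedL2.const hf₂))
  obtain ⟨K, hK⟩ := hGb
  obtain ⟨cR, hcR, hRb⟩ := exists_quadratic_bound R
  obtain ⟨Kx, hKx⟩ := hxb
  obtain ⟨Kv, hKv⟩ := hvb
  have hww := dotProduct_self_nonneg w₀
  have hwr : (w₀ ∘ Sum.inr) ⬝ᵥ (w₀ ∘ Sum.inr) ≤ w₀ ⬝ᵥ w₀ := by
    rw [Matrix.dotProduct_block w₀]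
    have := dotProduct_self_nonneg (w₀ ∘ Sum.inl)
    linarith
  refine ⟨cR * (w₀ ⬝ᵥ w₀) + 2 * |K| + w₀ ⬝ᵥ w₀ + 1, by positivity, fun ε h0 h1 => ?_⟩
  have hxl := (hKx ε h0 h1).1
  have hvl := (hKv ε h0 h1).1
  obtain ⟨hGl, hGK⟩ := hK ε h0 h1
  have hε : ε * ε⁻¹ = 1 := mul_inv_cancel₀ h0.ne'
  let w : ℝ → β → ℝ := fun t => layer (w₀ ∘ Sum.inr) ε t
  have hwl : IsL2 w := isL2_layer _ h0
  have hwl' : IsL2 fun t => -(ε⁻¹ • w t) := (MemLp.const_smul hwl ε⁻¹).neg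
  refine ⟨x ε, fun t => v ε t ∘ Sum.inr, fun t => v ε t ∘ Sum.inl,
    fun t => G ε t + -(ε⁻¹ • w t), hx0 ε, ?_, hxl, hvl.comp_index _, hvl.comp_index _,
    hGl.add hwl', ?_, ?_, ?_⟩
  · ext i
    simp [v, hx0, w₀, layer]
  · refine (hx' ε).congr_deriv fun t _ => ?_
    simp only [x', hB]
    rw [Matrix.fromCols_mulVec, add_right_comm (A₁ *ᵥ x ε t), add_assoc (A₁ *ᵥ x ε t)]
    abel
  · have hy := (((hx' ε).optimalFeedback B R P T.h_eq).add (isPrimitive_layer w₀ ε)).comp_index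
      (Sum.inr : β → κ ⊕ β)
    refine hy.congr_deriv fun t _ => ?_
    ext i
    simp only [G, w, h', layer, Function.comp_apply, Pi.add_apply, Pi.sub_apply, Pi.neg_apply,
      Pi.smul_apply]
    ring
  · have hcost := T.cost_eq hR hh hxl hvl (hx' ε)
    have hv : ∀ t, Sum.elim (v ε t ∘ Sum.inl) (v ε t ∘ Sum.inr) = v ε t := fun t =>
      Sum.elim_comp_inl_inr _
    simp only [hv]
    rw [hcost, hx0]
    have hdev : ∀ t, v ε t - optimalFeedback B R P (x ε t) (h t) = layer w₀ ε t := fun t => by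
      simp [v]
    simp only [hdev]
    have e1 := integral_dotProduct_mulVec_le hRb (isL2_layer w₀ h0)
    rw [integral_layer w₀ h0] at e1
    have e2 := integral_dotProduct_add_le hGl hwl'
    have e3 : ∫ t in Ioi (0 : ℝ), (-(ε⁻¹ • w t)) ⬝ᵥ (-(ε⁻¹ • w t)) =
        ε⁻¹ ^ 2 * (ε / 2 * ((w₀ ∘ Sum.inr) ⬝ᵥ (w₀ ∘ Sum.inr))) := by
      rw [← integral_layer _ h0, ← integral_const_mul]
      refine integral_congr_ae (ae_of_all _ fun t => ?_)
      simp only [w, neg_dotProduct_neg, smul_dotProduct, dotProduct_smul, smul_eq_mul]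
      ring
    rw [e3] at e2
    have e4 := mul_le_mul_of_nonneg_left e2 (sq_nonneg ε)
    have e5 : ε ^ 2 * (2 * (ε⁻¹ ^ 2 * (ε / 2 * ((w₀ ∘ Sum.inr) ⬝ᵥ (w₀ ∘ Sum.inr))))) =
        ε * ((w₀ ∘ Sum.inr) ⬝ᵥ (w₀ ∘ Sum.inr)) := by
      field_simp
    have e6 : ε ^ 2 * (2 * ∫ t in Ioi (0 : ℝ), G ε t ⬝ᵥ G ε t) ≤ ε * (2 * |K|) := by
      have h2 : ε ^ 2 ≤ ε := by nlinarith
      have h3 : 2 * ∫ t in Ioi (0 : ℝ), G ε t ⬝ᵥ G ε t ≤ 2 * |K| := by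
        linarith [le_abs_self K]
      calc _ ≤ ε ^ 2 * (2 * |K|) := mul_le_mul_of_nonneg_left h3 (sq_nonneg ε)
        _ ≤ ε * (2 * |K|) := mul_le_mul_of_nonneg_right h2 (by positivity)
    have e7 := mul_le_mul_of_nonneg_left hwr h0.le
    have e8 : 0 ≤ ε * (cR * (w₀ ⬝ᵥ w₀)) := by positivity
    rw [mul_add, e5] at e4
    linarith

end CompositeControl

/-! ### The optimal values -/

namespace Data

variable {p q m : ℕ} (d : Data p q m)

theorem aestronglyMeasurable_f
    (hmeas : AEMeasurable d.ℱ (volume.restrict (Ici (0 : ℝ)))) :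
    AEStronglyMeasurable d.f (volume.restrict (Ioi (0 : ℝ))) := by
  have h : AEStronglyMeasurable d.ℱ (volume.restrict (Ioi (0 : ℝ))) :=
    (hmeas.mono_measure (Measure.restrict_mono Ioi_subset_Ici_self le_rfl)).aestronglyMeasurable
  exact (LinearMap.toContinuousLinearMap d.T⁻¹.mulVecLin).continuous.comp_aestronglyMeasurable h

theorem exists_norm_f_le {a γ : ℝ}
    (hA4 : ∀ t : ℝ, 0 ≤ t → ‖WithLp.toLp 2 (d.ℱ t)‖ ≤ a * Real.exp (-γ * t)) :
    ∃ b, ∀ t, 0 ≤ t → ‖d.f t‖ ≤ b * Real.exp (-γ * t) := by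
  let L := LinearMap.toContinuousLinearMap d.T⁻¹.mulVecLin
  refine ⟨‖L‖ * a, fun t ht => (L.le_opNorm (d.ℱ t)).trans ?_⟩
  rw [mul_assoc]
  refine mul_le_mul_of_nonneg_left (le_trans ?_ (hA4 t ht)) (norm_nonneg _)
  exact (pi_norm_le_iff_of_nonneg (norm_nonneg _)).2
    fun i => PiLp.norm_apply_le (WithLp.toLp 2 (d.ℱ t)) i

/-- Open-loop controls belong to the class of admissible feedbacks. -/
theorem isAdmissible_openLoop {Z₀ : StateIx p q m → ℝ} {z : ℝ → StateIx p q m → ℝ}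
    {v : ℝ → CtrlIx q m → ℝ} (hz0 : z 0 = d.z₀ Z₀)
    (hz : IsPrimitive (fun t => d.A *ᵥ z t + d.B *ᵥ v t + d.f t) z) (hzl : IsL2 z)
    (hvl : IsL2 v) :
    d.IsAdmissible Z₀ (fun _ t => v t) ∧ d.IsTrajectory Z₀ (fun _ t => v t) z := by
  have htraj : d.IsTrajectory Z₀ (fun _ t => v t) z := ⟨hz, hz0⟩
  have huniq : ∀ z z', d.IsTrajectory Z₀ (fun _ t => v t) z →
      d.IsTrajectory Z₀ (fun _ t => v t) z' → EqOn z z' (Ici 0) := by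
    intro z z' h h'
    have key : ∀ z, d.IsTrajectory Z₀ (fun _ t => v t) z →
        IsPrimitive (fun t => d.A *ᵥ z t + (d.B *ᵥ v t + d.f t)) z := fun z h =>
      IsPrimitive.congr_deriv (isSolution_iff_isPrimitive.1 h.1) fun t _ => add_assoc _ _ _
    exact linear_solution_unique (key z h) (key z' h') (h.2.trans h'.2.symm)
  refine ⟨⟨⟨fun _ => ?_, fun _ => ⟨0, univ, univ_mem, fun t _ => ?_⟩⟩, ⟨z, htraj⟩, huniq,
    fun z' h' => ?_, fun _ _ => hvl⟩, htraj⟩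
  · rw [← restrict_Ioi_eq_restrict_Ici]
    exact hvl.aestronglyMeasurable.aemeasurable
  · exact (LipschitzWith.const (v t)).lipschitzOnWith
  · refine hzl.ae_eq ?_
    exact (ae_restrict_mem measurableSet_Ioi).mono fun t ht =>
      huniq z z' htraj h' (Ioi_subset_Ici_self ht)

/-- The cost is that of the reduced problem, with the fast state as a control, plus the cost of the
cheap control. -/
theorem costε_eq (hA2 : d.𝒟.PosSemidef) (hA5 : d.D₂.det ≠ 0) {ε : ℝ}
    {z : ℝ → StateIx p q m → ℝ} {v : ℝ → CtrlIx q m → ℝ} (hz : IsL2 z) (hv : IsL2 v) :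
    d.costε ε z v = (∫ t in Ioi (0 : ℝ), ((z t ∘ Sum.inl) ⬝ᵥ d.D₁ *ᵥ (z t ∘ Sum.inl) +
        Sum.elim (v t ∘ Sum.inl) (z t ∘ Sum.inr) ⬝ᵥ
          d.R₀ *ᵥ Sum.elim (v t ∘ Sum.inl) (z t ∘ Sum.inr))) +
      ε ^ 2 * ∫ t in Ioi (0 : ℝ), (v t ∘ Sum.inr) ⬝ᵥ (v t ∘ Sum.inr) := by
  have hx := hz.comp_index (Sum.inl : SlowIx p q → StateIx p q m)
  have hu := (hv.comp_index (Sum.inl : Fin q → CtrlIx q m)).sumElim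
    (hz.comp_index (Sum.inr : Fin m → StateIx p q m))
  have hu₂ := hv.comp_index (Sum.inr : Fin m → CtrlIx q m)
  have hi : IntegrableOn (fun t => (z t ∘ Sum.inl) ⬝ᵥ d.D₁ *ᵥ (z t ∘ Sum.inl) +
      Sum.elim (v t ∘ Sum.inl) (z t ∘ Sum.inr) ⬝ᵥ
        d.R₀ *ᵥ Sum.elim (v t ∘ Sum.inl) (z t ∘ Sum.inr)) (Ioi 0) :=
    (hx.integrable_dotProduct (hx.mulVec _)).add (hu.integrable_dotProduct (hu.mulVec _))
  rw [costε, ← integral_const_mul,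
    ← integral_add hi ((hu₂.integrable_dotProduct hu₂).const_mul _)]
  refine integral_congr_ae (ae_of_all _ fun t => ?_)
  simp only
  rw [d.D_eq hA2 hA5, d.Gε_eq, R₀, dotProduct_fromBlocks_diag, dotProduct_fromBlocks_diag,
    dotProduct_fromBlocks_diag]
  have : (Matrix.diagonal fun _ : Fin m => ε ^ 2) *ᵥ (v t ∘ Sum.inr) =
      ε ^ 2 • (v t ∘ Sum.inr) := by
    ext i
    simp [Matrix.mulVec_diagonal]
  rw [this, dotProduct_smul, smul_eq_mul, Sum.elim_comp_inl, Sum.elim_comp_inr]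
  ring

/-- The slow component of the dynamics is that of the reduced problem, controlled by `(u₁, y)`. -/
theorem rhs_comp_inl (hc : IsUnit (fromCols d.ℬtc d.ℬ₂).det) (z : StateIx p q m → ℝ)
    (v : CtrlIx q m → ℝ) (t : ℝ) :
    (d.A *ᵥ z + d.B *ᵥ v + d.f t) ∘ Sum.inl =
      d.A₁ *ᵥ (z ∘ Sum.inl) + d.Bbar *ᵥ Sum.elim (v ∘ Sum.inl) (z ∘ Sum.inr) + d.f₁ t := by
  rw [d.B_eq hc, d.A_eq, Matrix.fromBlocks_mulVec, Matrix.fromBlocks_mulVec, Bbar,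
    Matrix.fromCols_mulVec_sumElim]
  ext i
  simp only [Btil, f₁, Function.comp_apply, Pi.add_apply, Sum.elim_inl, Matrix.zero_mulVec,
    add_zero, A₁, A₂]
  ring

end Data

end CheapControl

open CheapControl in
theorem lemma4p5 {p q m k : ℕ} (hm : 0 < m) (d : CheapControl.Data p q m)
    -- the complement matrix makes `(ℬc, ℬ)` nonsingular
    (hc : IsUnit (Matrix.fromCols (Matrix.fromCols d.ℬc d.ℬ.toCols₁) d.ℬ.toCols₂).det)
    (hA1 : d.ℬ.rank = q + m)
    (hA2 : d.𝒟.PosSemidef)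
    (hA3 : ∀ i, 0 < d.g i)
    (hmeas : AEMeasurable d.ℱ (MeasureTheory.volume.restrict (Set.Ici (0 : ℝ))))
    (a γ : ℝ) (ha : 0 < a) (hγ : 0 < γ)
    (hA4 : ∀ t : ℝ, 0 ≤ t → ‖WithLp.toLp 2 (d.ℱ t)‖ ≤ a * Real.exp (-γ * t))
    (hA5 : (d.ℬ.toCols₂ᵀ * d.𝒟 * d.ℬ.toCols₂).det ≠ 0)
    (hA6 : CheapControl.IsStabilizable d.A₁ d.Bbar)
    (F₁ : Matrix (Fin k) (CheapControl.SlowIx p q) ℝ) (hF₁ : d.D₁ = F₁ᵀ * F₁)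
    (hA7 : CheapControl.IsDetectable d.A₁ F₁) :
    ∃ (P : Matrix (CheapControl.SlowIx p q) (CheapControl.SlowIx p q) ℝ)
      (h : ℝ → CheapControl.SlowIx p q → ℝ) (s : ℝ → ℝ),
      -- `P₁₀*`, `h₁₀`, `s₀` exist and are unique, so that `J̄*` is well defined
      d.IsReducedSolution P h s ∧
      (∀ P' h' s', d.IsReducedSolution P' h' s' →
        P' = P ∧ Set.EqOn h' h (Set.Ici 0) ∧ Set.EqOn s' s (Set.Ici 0)) ∧
      ∃ ε₂ > 0, ∀ Z₀ : CheapControl.StateIx p q m → ℝ, ∃ c > 0,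
        ∀ ε : ℝ, 0 < ε → ε ≤ ε₂ →
          -- the optimal value `J_ε*` exists (it is attained) and is close to `J̄*`
          ∃ Jε : ℝ, IsLeast (d.costValues Z₀ ε) Jε ∧ |Jε - d.Jbar Z₀ P h s| ≤ c * ε := by
  have hc' : IsUnit (fromCols d.ℬtc d.ℬ₂).det := hc
  have hD₂d : d.D₂.det ≠ 0 := hA5
  have hD₂ := d.D₂_posDef hA2 hD₂d
  have hD₁ := d.D₁_posSemidef hA2
  have hR₀ := d.R₀_posDef hA3 hD₂
  have hdet₁ : IsHautusDetectable d.A₁ d.D₁ := by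
    rw [hF₁]
    exact hA7.isHautusDetectable
  have hDps : d.D.PosSemidef := posSemidef_transpose_mul_mul hA2 _
  have hst : IsStabilizable d.A d.B := by
    rw [d.A_eq, d.B_eq hc']
    exact hA6.fromBlocks _ _ _
  have hdet : IsHautusDetectable d.A d.D := by
    rw [d.A_eq, d.D_eq hA2 hD₂d]
    exact hdet₁.fromBlocks hD₂ _ _ _
  have hfm := d.aestronglyMeasurable_f hmeas
  obtain ⟨b, hb⟩ := d.exists_norm_f_le hA4
  have hfl := isL2_of_exp_bound hγ hfm hb
  have hf₁l : IsL2 d.f₁ := hfl.comp_index Sum.inl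
  have hf₂l : IsL2 fun t => d.f t ∘ Sum.inr := hfl.comp_index Sum.inr
  have hb₁ : ∀ t, 0 ≤ t → ‖d.f₁ t‖ ≤ b * Real.exp (-γ * t) := fun t ht =>
    ((pi_norm_le_iff_of_nonneg (norm_nonneg _)).2
      fun i => norm_le_pi_norm (d.f t) (Sum.inl i)).trans (hb t ht)
  obtain ⟨P, h, s, T, hh⟩ := exists_isValueTriple (B := d.Bbar) hR₀ hD₁ hA6 hdet₁ hγ
    hf₁l.aestronglyMeasurable hb₁
  refine ⟨P, h, s, (d.isReducedSolution_iff hA3 hD₂d).2 T, fun P' h' s' T' =>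
    T.unique hR₀ hD₁ hdet₁ ((d.isReducedSolution_iff hA3 hD₂d).1 T'), 1, one_pos, fun Z₀ => ?_⟩
  obtain ⟨c, hcpos, hcomp⟩ := IsValueTriple.exists_composite_control (A₂ := d.A₂)
    (E := Data.Btil p q) T hR₀ hD₁ hdet₁ hh hf₁l hf₂l d.A.toBlocks₂₁ d.A.toBlocks₂₂ d.H₂ (d.x₀ Z₀)
    (d.z₀ Z₀ ∘ Sum.inr)
  refine ⟨c, hcpos, fun ε h0 h1 => ?_⟩
  have hGε := d.Gε_posDef hA3 h0
  obtain ⟨Pε, hε, sε, Tε, hhε⟩ := exists_isValueTriple hGε hDps hst hdet hγ hfm hb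
  have hlb : ∀ J ∈ d.costValues Z₀ ε,
      d.z₀ Z₀ ⬝ᵥ Pε *ᵥ d.z₀ Z₀ + 2 * (hε 0 ⬝ᵥ d.z₀ Z₀) + sε 0 ≤ J := by
    rintro J ⟨u, z, hu, hz, rfl⟩
    rw [← hz.2]
    exact Tε.le_cost hGε hhε (hu.state_sq z hz) (hu.control_sq z hz) hz.1
  obtain ⟨z, v, hz0, hzl, hvl, hz, hJ⟩ :=
    Tε.exists_optimal hGε hDps hdet hhε hfl (d.z₀ Z₀)
  rw [hz0] at hJ
  have hcost : d.costε ε z v = _ := hJ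
  refine ⟨_, ⟨⟨fun _ t => v t, z, (d.isAdmissible_openLoop hz0 hz hzl hvl).1,
    (d.isAdmissible_openLoop hz0 hz hzl hvl).2, hcost.symm⟩, hlb⟩, ?_⟩
  have hx₀ : z 0 ∘ Sum.inl = d.x₀ Z₀ := by
    rw [hz0]
    rfl
  have hJbar : d.Jbar Z₀ P h s = d.x₀ Z₀ ⬝ᵥ P *ᵥ d.x₀ Z₀ + 2 * (h 0 ⬝ᵥ d.x₀ Z₀) + s 0 := rfl
  rw [abs_le]
  constructor
  · -- in the reduced problem the fast state acts as a control
    have hred := T.le_cost hR₀ hh (hzl.comp_index Sum.inl)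
      ((hvl.comp_index Sum.inl).sumElim (hzl.comp_index Sum.inr))
      ((hz.comp_index Sum.inl).congr_deriv fun t _ => d.rhs_comp_inl hc' _ _ t)
    rw [hx₀] at hred
    have hpos : 0 ≤ ε ^ 2 * ∫ t in Set.Ioi (0 : ℝ), (v t ∘ Sum.inr) ⬝ᵥ (v t ∘ Sum.inr) :=
      mul_nonneg (sq_nonneg ε) (integral_nonneg fun t => dotProduct_self_nonneg _)
    rw [d.costε_eq hA2 hD₂d hzl hvl] at hcost
    have : 0 ≤ c * ε := by positivity
    rw [hJbar, ← hcost]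
    linarith
  · obtain ⟨x, y, u₁, u₂, hx0, hy0, hxl, hyl, hu₁l, hu₂l, hx, hy, hle⟩ := hcomp ε h0 h1
    have hZ0 : Sum.elim (x 0) (y 0) = d.z₀ Z₀ := by
      rw [hx0, hy0]
      exact Sum.elim_comp_inl_inr (d.z₀ Z₀)
    have hZ : IsPrimitive (fun t => d.A *ᵥ Sum.elim (x t) (y t) + d.B *ᵥ Sum.elim (u₁ t) (u₂ t) +
        d.f t) (fun t => Sum.elim (x t) (y t)) := by
      refine (hx.sumElim hy).congr_deriv fun t _ => ?_
      rw [d.B_eq hc']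
      nth_rewrite 3 [d.A_eq]
      rw [Matrix.fromBlocks_mulVec, Matrix.fromBlocks_mulVec]
      simp only [Sum.elim_comp_inl, Sum.elim_comp_inr, Matrix.zero_mulVec, add_zero,
        Matrix.one_mulVec]
      ext (i | i)
      · rfl
      · simp only [Sum.elim_inr, Pi.add_apply, Function.comp_apply]
        ring
    obtain ⟨hadm, htraj⟩ := d.isAdmissible_openLoop hZ0 hZ (hxl.sumElim hyl) (hu₁l.sumElim hu₂l)
    have hup := hlb _ ⟨_, _, hadm, htraj, rfl⟩
    rw [d.costε_eq hA2 hD₂d (hxl.sumElim hyl) (hu₁l.sumElim hu₂l)] at hup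
    simp only [Sum.elim_comp_inl, Sum.elim_comp_inr] at hup
    rw [hJbar]
    linarith
end
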